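/- Let $d\ge 0$ be an integer and let $L=L(x,s,\xi):\mathbb R^d\times\mathbb R\times\mathbb R^d\to\mathbb R$ satisfy: (L1) $L$ is of class $C^2$; (L2) the Hessian matrix $\frac{\partial^2L}{\partial\xi^2}(x,s,\xi)$ is positive definite for every $(x,s,\xi)$; (L3) for each $a\ge 0$ there is $b_a\in\mathbb R$ such that $L(x,s,\xi)\ge a|\xi|+b_a$ for all $(x,s,\xi)$; (L4) the Euler–Lagrange flow of $L$ is complete: for every $s_0\in\mathbb R$ and $x_0,v_0\in\mathbb R^d$ there is a $C^2$ curve $\gamma:\mathbb R\to\mathbb R^d$ with $\gamma(s_0)=x_0$, $\gamma'(s_0)=v_0$ that solves $$\frac{d}{ds}\frac{\partial L}{\partial\xi}(\gamma(s),s,\gamma'(s))=\frac{\partial L}{\partial x}(\gamma(s),s,\gamma'(s))\qquad(\mathrm{EL})$$ for all $s\in\mathbb R$. For $t>0$ let $C^1_{\mathrm{pw}}([0,t];\mathbb R^d)$ be the set of continuous curves $\gamma:[0,t]\to\mathbb R^d$ for which there is a finite division $0=\tau_0<\tau_1<\dots<\tau_m=t$, $m\ge1$, such that $\gamma$ is $C^1$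 on each $[\tau_{l-1},\tau_l]$, and let $$\mathcal L_0(\gamma)=\int_0^tL(\gamma(s),s,\gamma'(s))\,ds .$$ Then for every $t>0$ and all $x,\tilde x\in\mathbb R^d$, the integrand of $\mathcal L_0(\gamma)$ is integrable on $[0,t]$ for every $\gamma\in C^1_{\mathrm{pw}}([0,t];\mathbb R^d)$ with $\gamma(0)=\tilde x$ and $\gamma(t)=x$, and the infimum $$\inf\{\mathcal L_0(\gamma)\;:\;\gamma\in C^1_{\mathrm{pw}}([0,t];\mathbb R^d),\ \gamma(0)=\tilde x,\ \gamma(t)=x\}$$ is attained by a curve $\gamma^\ast$ in this class that is of class $C^2$ on $[0,t]$ and solves (EL) on $[0,t]$ (with one-sided derivatives at the end points). -/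

import Mathlib

open Set MeasureTheory

/-- `ℝ^d` with the Euclidean norm and the standard dot product. -/
abbrev Space (d : ℕ) : Type := EuclideanSpace ℝ (Fin d)

/-- The vector `∂L/∂x (x, s, ξ)`. -/
noncomputable def gradX {d : ℕ} (L : Space d → ℝ → Space d → ℝ) (x : Space d) (s : ℝ)
    (ξ : Space d) : Space d :=
  gradient (fun y => L y s ξ) x

/-- The vector `∂L/∂ξ (x, s, ξ)`. -/
noncomputable def gradXi {d : ℕ} (L : Space d → ℝ → Space d → ℝ) (x : Space d) (s : ℝ)
    (ξ : Space d) : Space d :=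
  gradient (fun η => L x s η) ξ

/-- `γ` solves the Euler–Lagrange equation
`d/ds (∂L/∂ξ)(γ(s), s, γ'(s)) = (∂L/∂x)(γ(s), s, γ'(s))` on the interval `I`.
Derivatives are taken within `I`, i.e. they are one-sided at the end points that `I` contains. -/
def SolvesEulerLagrange {d : ℕ} (L : Space d → ℝ → Space d → ℝ) (I : Set ℝ)
    (γ : ℝ → Space d) : Prop :=
  ∀ s ∈ I, HasDerivWithinAt (fun r => gradXi L (γ r) r (derivWithin γ I r))
    (gradX L (γ s) s (derivWithin γ I s)) I s

/-- The conditions (L1)–(L4) on a Lagrangian `L = L(x, s, ξ)`. -/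
structure IsTonelliLagrangian {d : ℕ} (L : Space d → ℝ → Space d → ℝ) : Prop where
  /-- (L1): `L` is `C^2` jointly in its variables. -/
  contDiff : ContDiff ℝ 2 (fun p : Space d × ℝ × Space d => L p.1 p.2.1 p.2.2)
  /-- (L2): the Hessian of `L` in `ξ`, as a bilinear form, is positive definite everywhere. -/
  hessian_pos : ∀ (x : Space d) (s : ℝ) (ξ v : Space d), v ≠ 0 →
    0 < fderiv ℝ (fderiv ℝ (fun η => L x s η)) ξ v v
  /-- (L3): `L` is uniformly superlinear. -/
  superlinear : ∀ a : ℝ, 0 ≤ a → ∃ b : ℝ, ∀ (x : Space d) (s : ℝ) (ξ : Space d),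
    a * ‖ξ‖ + b ≤ L x s ξ
  /-- (L4): the Euler–Lagrange flow is complete: from every initial time, position and velocity
  there is a solution of the Euler–Lagrange equation defined for all times. -/
  complete : ∀ (s₀ : ℝ) (x₀ v₀ : Space d), ∃ γ : ℝ → Space d,
    ContDiff ℝ 2 γ ∧ γ s₀ = x₀ ∧ deriv γ s₀ = v₀ ∧ SolvesEulerLagrange L univ γ

/-- `γ` is continuous and piecewise `C^1` on `[0, t]`: there is a finite division
`0 = τ 0 < τ 1 < ⋯ < τ m = t`, `m ≥ 1`, such that `γ` is `C^1` on each closed piece.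
Only the values of `γ` on `[0, t]` matter. -/
def IsPiecewiseC1 {d : ℕ} (t : ℝ) (γ : ℝ → Space d) : Prop :=
  ContinuousOn γ (Icc 0 t) ∧
    ∃ (m : ℕ) (τ : ℕ → ℝ), 1 ≤ m ∧ τ 0 = 0 ∧ τ m = t ∧
      ∀ l < m, τ l < τ (l + 1) ∧ ContDiffOn ℝ 1 γ (Icc (τ l) (τ (l + 1)))

/-- The competitors: continuous piecewise `C^1` curves on `[0, t]` from `xtilde` to `x`. -/
def admissibleCurves {d : ℕ} (t : ℝ) (xtilde x : Space d) : Set (ℝ → Space d) :=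
  {γ | IsPiecewiseC1 t γ ∧ γ 0 = xtilde ∧ γ t = x}

/-- The integrand `s ↦ L(γ(s), s, γ'(s))` of the action on `[0, t]`. -/
noncomputable def lagrangianAlong {d : ℕ} (L : Space d → ℝ → Space d → ℝ) (t : ℝ)
    (γ : ℝ → Space d) (s : ℝ) : ℝ :=
  L (γ s) s (derivWithin γ (Icc 0 t) s)

/-- The action `𝓛₀(γ) = ∫₀ᵗ L(γ(s), s, γ'(s)) ds`. -/
noncomputable def action {d : ℕ} (L : Space d → ℝ → Space d → ℝ) (t : ℝ)
    (γ : ℝ → Space d) : ℝ :=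
  ∫ s in (0 : ℝ)..t, lagrangianAlong L t γ s

open scoped RealInnerProductSpace Topology

/-! ### Differential calculus of the Lagrangian and velocities constrained to a ball -/

section Calculus

variable {d : ℕ} {L : Space d → ℝ → Space d → ℝ}

/-! The velocities are first confined to a ball of radius R. Weak L² compactness and convexity in ξ
then give a minimizing control (`IsTonelliLagrangian.exists_isControl_min`). Its first variation,
with a Lagrange multiplier from Hahn–Banach for the fixed end point (`exists_multiplier`), yields a
momentum p with p' = ∂L/∂x such that almost everywhere the velocity minimizes L(x,s,w) − ⟨p,w⟩ over
the ball (`exists_momentum_of_min`). Strong monotonicity of ∂L/∂ξ makes this minimizer unique and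
locally Lipschitz in (x,s,p). Hence the control may be taken continuous, and Grönwall's inequality
applies to the resulting Hamiltonian system (`IsTonelliLagrangian.exists_comparison`).

The constraint is removed by letting R tend to infinity. The straight segment bounds the minimal
actions, and superlinearity turns this into a bound on the L¹ norms of the velocities. So the curves
stay in a fixed ball, and each has at some time a velocity bounded independently of R. Along a
subsequence these times, positions and velocities converge, and (L4) supplies an Euler–Lagrange
solution through the limit on all of [0,t]. Continuous dependence keeps the constrained extremals
close to it, so their velocities stay below some R'
(`IsTonelliLagrangian.exists_subseq_velocity_lt`). Once R ≥ R' the constraint is inactive: the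
minimizer coincides on [0,t] with a complete Euler–Lagrange solution, which is C², and it is minimal
for every bound (`IsTonelliLagrangian.exists_extremal_min`). A piecewise C¹ curve has bounded
velocity off finitely many times, so it is one of the competitors. -/

theorem gradX_eq_of_contDiff
    (hL : ContDiff ℝ 2 (fun p : Space d × ℝ × Space d => L p.1 p.2.1 p.2.2))
    (p : Space d × ℝ × Space d) :
    gradX L p.1 p.2.1 p.2.2 = (InnerProductSpace.toDual ℝ (Space d)).symm
      ((fderiv ℝ (fun p : Space d × ℝ × Space d => L p.1 p.2.1 p.2.2) p).comp
        (ContinuousLinearMap.inl ℝ (Space d) (ℝ × Space d))) := by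
  have h := (hL.differentiable (by norm_num) p).hasFDerivAt
  have h2 : HasFDerivAt (fun y : Space d => (y, p.2)) (ContinuousLinearMap.inl ℝ _ _) p.1 :=
    hasFDerivAt_prodMk_left p.1 p.2
  have h3 := HasFDerivAt.comp (f := fun y : Space d => (y, p.2)) p.1 h h2
  unfold gradX gradient
  congr 1
  exact h3.fderiv

theorem gradXi_eq_of_contDiff
    (hL : ContDiff ℝ 2 (fun p : Space d × ℝ × Space d => L p.1 p.2.1 p.2.2))
    (p : Space d × ℝ × Space d) :
    gradXi L p.1 p.2.1 p.2.2 = (InnerProductSpace.toDual ℝ (Space d)).symm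
      ((fderiv ℝ (fun p : Space d × ℝ × Space d => L p.1 p.2.1 p.2.2) p).comp
        ((ContinuousLinearMap.inr ℝ (Space d) (ℝ × Space d)).comp
          (ContinuousLinearMap.inr ℝ ℝ (Space d)))) := by
  have h := (hL.differentiable (by norm_num) p).hasFDerivAt
  have h1 : HasFDerivAt (fun y : Space d => (p.2.1, y)) (ContinuousLinearMap.inr ℝ _ _) p.2.2 :=
    hasFDerivAt_prodMk_right p.2.1 p.2.2
  have h2 : HasFDerivAt (fun y : ℝ × Space d => (p.1, y)) (ContinuousLinearMap.inr ℝ _ _) p.2 :=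
    hasFDerivAt_prodMk_right p.1 p.2
  have h3 := HasFDerivAt.comp (f := fun y : Space d => (p.1, p.2.1, y)) p.2.2 h
    (HasFDerivAt.comp (f := fun y : Space d => (p.2.1, y)) p.2.2 h2 h1)
  unfold gradXi gradient
  congr 1
  exact h3.fderiv

theorem contDiff_gradX
    (hL : ContDiff ℝ 2 (fun p : Space d × ℝ × Space d => L p.1 p.2.1 p.2.2)) :
    ContDiff ℝ 1 (fun p : Space d × ℝ × Space d => gradX L p.1 p.2.1 p.2.2) := by
  have h : ContDiff ℝ 1 (fderiv ℝ (fun p : Space d × ℝ × Space d => L p.1 p.2.1 p.2.2)) :=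
    hL.fderiv_right (by norm_num)
  rw [funext (gradX_eq_of_contDiff hL)]
  exact (InnerProductSpace.toDual ℝ (Space d)).symm.toContinuousLinearEquiv.contDiff.comp
    (h.clm_comp contDiff_const)

theorem contDiff_gradXi
    (hL : ContDiff ℝ 2 (fun p : Space d × ℝ × Space d => L p.1 p.2.1 p.2.2)) :
    ContDiff ℝ 1 (fun p : Space d × ℝ × Space d => gradXi L p.1 p.2.1 p.2.2) := by
  have h : ContDiff ℝ 1 (fderiv ℝ (fun p : Space d × ℝ × Space d => L p.1 p.2.1 p.2.2)) :=
    hL.fderiv_right (by norm_num)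
  rw [funext (gradXi_eq_of_contDiff hL)]
  exact (InnerProductSpace.toDual ℝ (Space d)).symm.toContinuousLinearEquiv.contDiff.comp
    (h.clm_comp contDiff_const)

theorem hasDerivAt_lagrangian_comp
    (hL : ContDiff ℝ 2 (fun p : Space d × ℝ × Space d => L p.1 p.2.1 p.2.2))
    {a b : ℝ → Space d} {a' b' : Space d} {r : ℝ} (s : ℝ)
    (ha : HasDerivAt a a' r) (hb : HasDerivAt b b' r) :
    HasDerivAt (fun r => L (a r) s (b r))
      (⟪gradX L (a r) s (b r), a'⟫ + ⟪gradXi L (a r) s (b r), b'⟫) r := by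
  have h := (hL.differentiable (by norm_num) (a r, s, b r)).hasFDerivAt
  have h2 := HasFDerivAt.comp_hasDerivAt (f := fun r => (a r, s, b r)) r h
    (ha.prodMk ((hasDerivAt_const r s).prodMk hb))
  have e1 := gradX_eq_of_contDiff hL (a r, s, b r)
  have e2 := gradXi_eq_of_contDiff hL (a r, s, b r)
  simp only at e1 e2
  have e : ⟪gradX L (a r) s (b r), a'⟫ + ⟪gradXi L (a r) s (b r), b'⟫ =
      fderiv ℝ (fun p : Space d × ℝ × Space d => L p.1 p.2.1 p.2.2) (a r, s, b r) (a', 0, b') := by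
    rw [e1, e2, InnerProductSpace.toDual_symm_apply, InnerProductSpace.toDual_symm_apply]
    simp only [ContinuousLinearMap.comp_apply, ContinuousLinearMap.inl_apply,
      ContinuousLinearMap.inr_apply]
    rw [← map_add]
    simp
  rw [e]
  exact h2

theorem hasDerivAt_gradXi_segment
    (hL : ContDiff ℝ 2 (fun p : Space d × ℝ × Space d => L p.1 p.2.1 p.2.2))
    (x : Space d) (s : ℝ) (ξ v : Space d) (r : ℝ) :
    HasDerivAt (fun r : ℝ => ⟪gradXi L x s (ξ + r • v), v⟫)
      (fderiv ℝ (fderiv ℝ (fun η => L x s η)) (ξ + r • v) v v) r := by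
  have hc : ContDiff ℝ 2 (fun η => L x s η) :=
    hL.comp (f := fun η : Space d => (x, s, η)) (by fun_prop)
  have h1 : ContDiff ℝ 1 (fderiv ℝ (fun η => L x s η)) := hc.fderiv_right (by norm_num)
  have h2 := (h1.differentiable (by norm_num) (ξ + r • v)).hasFDerivAt
  have h3 : HasDerivAt (fun r : ℝ => ξ + r • v) v r := by
    simpa using ((hasDerivAt_id r).smul_const v).const_add ξ
  have h4 := (HasFDerivAt.comp_hasDerivAt (f := fun r : ℝ => ξ + r • v) r h2 h3).clm_apply
    (hasDerivAt_const r v)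
  simp only [map_zero, add_zero] at h4
  have e : (fun r : ℝ => ⟪gradXi L x s (ξ + r • v), v⟫) =
      fun r : ℝ => fderiv ℝ (fun η => L x s η) (ξ + r • v) v := by
    funext r
    rw [gradXi, gradient, InnerProductSpace.toDual_symm_apply]
  rw [e]
  exact h4

theorem fderiv_fderiv_eq_inner_fderiv_gradXi
    (hL : ContDiff ℝ 2 (fun p : Space d × ℝ × Space d => L p.1 p.2.1 p.2.2))
    (x : Space d) (s : ℝ) (ξ v : Space d) :
    fderiv ℝ (fderiv ℝ (fun η => L x s η)) ξ v v =
      ⟪fderiv ℝ (fun p : Space d × ℝ × Space d => gradXi L p.1 p.2.1 p.2.2) (x, s, ξ) (0, 0, v),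
        v⟫ := by
  have h1 := hasDerivAt_gradXi_segment hL x s ξ v 0
  have h3 : HasDerivAt (fun r : ℝ => (x, s, ξ + r • v)) (0, 0, v) 0 := by
    refine (hasDerivAt_const _ _).prodMk ((hasDerivAt_const _ _).prodMk ?_)
    simpa using ((hasDerivAt_id (0 : ℝ)).smul_const v).const_add ξ
  have h2 := ((contDiff_gradXi hL).differentiable (by norm_num) (x, s, ξ + (0 : ℝ) • v)).hasFDerivAt
  have h4 := HasFDerivAt.comp_hasDerivAt (f := fun r : ℝ => (x, s, ξ + r • v)) 0 h2 h3
  have h5 := h4.inner ℝ (hasDerivAt_const (0 : ℝ) v)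
  have := h1.unique h5
  simpa using this

/-- On a compact set of base points, `∂L/∂ξ` is strongly monotone in `ξ`. -/
theorem IsTonelliLagrangian.exists_strongMono (hL : IsTonelliLagrangian L) (ρ T R : ℝ) :
    ∃ m : ℝ, 0 < m ∧ ∀ x s ξ η, ‖x‖ ≤ ρ → |s| ≤ T → ‖ξ‖ ≤ R → ‖η‖ ≤ R →
      m * ‖ξ - η‖ ^ 2 ≤ ⟪gradXi L x s ξ - gradXi L x s η, ξ - η⟫ := by
  have hc := hL.contDiff
  set G : (Space d × ℝ × Space d) → (Space d × ℝ × Space d) →L[ℝ] Space d :=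
    fderiv ℝ (fun p : Space d × ℝ × Space d => gradXi L p.1 p.2.1 p.2.2) with hG
  have hGc : Continuous G := (contDiff_gradXi hc).continuous_fderiv (by norm_num)
  set F : (Space d × ℝ × Space d) × Space d → ℝ := fun z => ⟪G z.1 (0, 0, z.2), z.2⟫ with hF
  have hFc : Continuous F := by
    refine Continuous.inner ?_ continuous_snd
    exact (hGc.comp continuous_fst).clm_apply (by fun_prop)
  set K : Set ((Space d × ℝ × Space d) × Space d) :=
    (Metric.closedBall 0 ρ ×ˢ (Icc (-T) T ×ˢ Metric.closedBall 0 R)) ×ˢ Metric.sphere 0 1 with hK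
  have hKc : IsCompact K := ((isCompact_closedBall 0 ρ).prod
    (isCompact_Icc.prod (isCompact_closedBall 0 R))).prod (isCompact_sphere 0 1)
  obtain ⟨m, hm, hmK⟩ : ∃ m : ℝ, 0 < m ∧ ∀ z ∈ K, m ≤ F z := by
    rcases K.eq_empty_or_nonempty with h | h
    -- `K` is empty for negative radii, and also for d = 0, where there are no unit vectors.
    · exact ⟨1, one_pos, by simp [h]⟩
    · obtain ⟨z, hz, hmin⟩ := hKc.exists_isMinOn h hFc.continuousOn
      refine ⟨F z, ?_, fun y hy => hmin hy⟩
      rw [hF]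
      simp only
      rw [hG, ← fderiv_fderiv_eq_inner_fderiv_gradXi hc]
      apply hL.hessian_pos
      have : z.2 ∈ Metric.sphere (0 : Space d) 1 := hz.2
      intro h0
      rw [h0] at this
      simp at this
  refine ⟨m, hm, fun x s ξ η hx hs hξ hη => ?_⟩
  set v := ξ - η with hv
  have key : ∀ r ∈ Icc (0 : ℝ) 1, m * ‖v‖ ^ 2 ≤
      fderiv ℝ (fderiv ℝ (fun η => L x s η)) (η + r • v) v v := by
    intro r hr
    rcases eq_or_ne v 0 with h0 | h0
    · simp [h0]
    have hn : 0 < ‖v‖ := norm_pos_iff.2 h0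
    have hmem : ((x, s, η + r • v), ‖v‖⁻¹ • v) ∈ K := by
      refine ⟨⟨by simpa using hx, ⟨abs_le.1 hs, ?_⟩⟩, ?_⟩
      · have : η + r • v ∈ segment ℝ η ξ := by
          rw [segment_eq_image']
          exact ⟨r, hr, rfl⟩
        exact (convex_closedBall (0 : Space d) R).segment_subset (by simpa using hη)
          (by simpa using hξ) this
      · simp [norm_smul, hn.ne']
    have h1 := hmK _ hmem
    rw [hF] at h1
    simp only at h1
    rw [hG, ← fderiv_fderiv_eq_inner_fderiv_gradXi hc] at h1
    simp only [map_smul, smul_eq_mul, smul_apply] at h1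
    have h2 : ‖v‖⁻¹ * (‖v‖⁻¹ * (fderiv ℝ (fderiv ℝ fun η => L x s η) (η + r • v)) v v)
      = ((fderiv ℝ (fderiv ℝ fun η => L x s η) (η + r • v)) v v) / ‖v‖ ^ 2 := by
      field_simp
    rw [h2, le_div_iff₀ (by positivity)] at h1
    exact h1
  have hd := hasDerivAt_gradXi_segment hc x s η v
  -- Mean value theorem along the segment from η to ξ, on which the Hessian is bounded below by
  -- `key`.
  obtain ⟨r, hr, he⟩ := exists_hasDerivAt_eq_slope (fun r : ℝ => ⟪gradXi L x s (η + r • v), v⟫)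
    _ zero_lt_one (fun r _ => (hd r).continuousAt.continuousWithinAt) (fun r _ => hd r)
  have := key r (Ioo_subset_Icc_self hr)
  rw [he] at this
  simpa [hv, inner_sub_left] using this

theorem IsTonelliLagrangian.mono_gradXi (hL : IsTonelliLagrangian L) (x : Space d) (s : ℝ)
    (ξ η : Space d) : 0 ≤ ⟪gradXi L x s ξ - gradXi L x s η, ξ - η⟫ := by
  obtain ⟨m, hm, h⟩ := hL.exists_strongMono ‖x‖ |s| (max ‖ξ‖ ‖η‖)
  exact (by positivity : 0 ≤ m * ‖ξ - η‖ ^ 2).trans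
    (h x s ξ η le_rfl le_rfl (le_max_left _ _) (le_max_right _ _))

/-- The tangent inequality for the convex function `L x s`. -/
theorem IsTonelliLagrangian.tangent_le (hL : IsTonelliLagrangian L) (x : Space d) (s : ℝ)
    (ξ η : Space d) : L x s ξ + ⟪gradXi L x s ξ, η - ξ⟫ ≤ L x s η := by
  set v := η - ξ with hv
  have hd : ∀ r : ℝ, HasDerivAt (fun r : ℝ => L x s (ξ + r • v))
      ⟪gradXi L x s (ξ + r • v), v⟫ r := by
    intro r
    have h3 : HasDerivAt (fun r : ℝ => ξ + r • v) v r := by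
      simpa using ((hasDerivAt_id r).smul_const v).const_add ξ
    simpa using hasDerivAt_lagrangian_comp hL.contDiff s (hasDerivAt_const r x) h3
  obtain ⟨r, hr, he⟩ := exists_hasDerivAt_eq_slope _ _ zero_lt_one
    (fun r _ => (hd r).continuousAt.continuousWithinAt) (fun r _ => hd r)
  -- Monotonicity, divided by r > 0, compares the slope at the intermediate point with the slope at
  -- ξ.
  have h1 := hL.mono_gradXi x s (ξ + r • v) ξ
  rw [add_sub_cancel_left, inner_smul_right, inner_sub_left] at h1
  have h2 := nonneg_of_mul_nonneg_right h1 hr.1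
  simp only [one_smul, zero_smul, add_zero, sub_zero, div_one] at he
  have : ξ + v = η := by rw [hv]; abel
  rw [this] at he
  linarith

theorem exists_lipschitz_of_contDiff {F : Type*} [NormedAddCommGroup F] [NormedSpace ℝ F]
    {f : Space d × ℝ × Space d → F} (hf : ContDiff ℝ 1 f) (ρ T R : ℝ) :
    ∃ C : ℝ, 0 ≤ C ∧ ∀ x y s r ξ η, ‖x‖ ≤ ρ → ‖y‖ ≤ ρ → |s| ≤ T → |r| ≤ T → ‖ξ‖ ≤ R → ‖η‖ ≤ R →
      ‖f (x, s, ξ) - f (y, r, η)‖ ≤ C * (‖x - y‖ + |s - r| + ‖ξ - η‖) := by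
  have hKc : IsCompact (Metric.closedBall (0 : Space d) ρ ×ˢ
      (Icc (-T) T ×ˢ Metric.closedBall (0 : Space d) R)) :=
    ((isCompact_closedBall 0 ρ).prod (isCompact_Icc.prod (isCompact_closedBall 0 R)))
  obtain ⟨C, hC⟩ := (hf.locallyLipschitz.locallyLipschitzOn).exists_lipschitzOnWith_of_compact hKc
  refine ⟨C, C.2, fun x y s r ξ η hx hy hs hr hξ hη => ?_⟩
  have := hC.dist_le_mul (x, s, ξ) ⟨by simpa using hx, abs_le.1 hs, by simpa using hξ⟩
    (y, r, η) ⟨by simpa using hy, abs_le.1 hr, by simpa using hη⟩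
  rw [dist_eq_norm] at this
  refine this.trans (mul_le_mul_of_nonneg_left ?_ C.2)
  rw [Prod.dist_eq, Prod.dist_eq, dist_eq_norm, dist_eq_norm, dist_eq_norm]
  simp only [Real.norm_eq_abs]
  have a1 := norm_nonneg (x - y)
  have a2 := norm_nonneg (ξ - η)
  have a3 := abs_nonneg (s - r)
  refine max_le (by linarith) (max_le (by linarith) (by linarith))

/-- `q` is the minimizer of `w ↦ L x s w - ⟪p, w⟫` over the closed ball of radius `R`, expressed
by its variational inequality. -/
def IsConstrainedVelocity (L : Space d → ℝ → Space d → ℝ) (R : ℝ) (x : Space d) (s : ℝ)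
    (p q : Space d) : Prop :=
  ‖q‖ ≤ R ∧ ∀ w : Space d, ‖w‖ ≤ R → 0 ≤ ⟪gradXi L x s q - p, w - q⟫

/-- A minimizer over the compact ball exists by continuity. Moving from it towards another point of
the ball is possible in one direction only, so stationarity becomes an inequality. -/
theorem exists_isConstrainedVelocity
    (hL : ContDiff ℝ 2 (fun p : Space d × ℝ × Space d => L p.1 p.2.1 p.2.2))
    {R : ℝ} (hR : 0 ≤ R) (x : Space d) (s : ℝ) (p : Space d) :
    ∃ q, IsConstrainedVelocity L R x s p q := by
  have hcont : Continuous fun w => L x s w - ⟪p, w⟫ := by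
    have := hL.continuous.comp (f := fun w : Space d => (x, s, w)) (by fun_prop)
    exact this.sub (by fun_prop)
  obtain ⟨q, hq, hmin⟩ := (isCompact_closedBall (0 : Space d) R).exists_isMinOn
    (Metric.nonempty_closedBall.2 hR) hcont.continuousOn
  have hq' : ‖q‖ ≤ R := by simpa using hq
  refine ⟨q, hq', fun w hw => ?_⟩
  have hd : HasDerivAt (fun r : ℝ => L x s (q + r • (w - q)) - ⟪p, q + r • (w - q)⟫)
      ⟪gradXi L x s q - p, w - q⟫ 0 := by
    have h3 : HasDerivAt (fun r : ℝ => q + r • (w - q)) (w - q) 0 := by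
      simpa using ((hasDerivAt_id (0 : ℝ)).smul_const (w - q)).const_add q
    have h4 := (hasDerivAt_lagrangian_comp hL s (hasDerivAt_const (0 : ℝ) x) h3).sub
      ((hasDerivAt_const (0 : ℝ) p).inner ℝ h3)
    simp only [inner_zero_right, inner_zero_left, zero_add, add_zero, zero_smul] at h4
    rw [inner_sub_left]
    exact h4
  have hm : IsLocalMinOn (fun r : ℝ => L x s (q + r • (w - q)) - ⟪p, q + r • (w - q)⟫)
      (Icc 0 1) 0 := by
    refine IsMinOn.localize fun r hr => ?_
    have : q + r • (w - q) ∈ Metric.closedBall (0 : Space d) R := by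
      refine (convex_closedBall (0 : Space d) R).segment_subset hq (by simpa using hw) ?_
      rw [segment_eq_image']
      exact ⟨r, hr, rfl⟩
    simpa using hmin this
  have := hm.hasFDerivWithinAt_nonneg (y := 1) hd.hasFDerivAt.hasFDerivWithinAt
    (mem_posTangentConeAt_of_segment_subset (by rw [zero_add, segment_eq_Icc zero_le_one]))
  simpa using this

/-- Constrained velocities depend in a Lipschitz way on position, time and momentum. -/
theorem IsTonelliLagrangian.exists_constrainedVelocity_lipschitz (hL : IsTonelliLagrangian L)
    (ρ T R : ℝ) :
    ∃ C : ℝ, 0 ≤ C ∧ ∀ x y s r p p' q q', ‖x‖ ≤ ρ → ‖y‖ ≤ ρ → |s| ≤ T → |r| ≤ T →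
      IsConstrainedVelocity L R x s p q → IsConstrainedVelocity L R y r p' q' →
      ‖q - q'‖ ≤ C * (‖x - y‖ + |s - r| + ‖p - p'‖) := by
  obtain ⟨m, hm, hmono⟩ := hL.exists_strongMono ρ T R
  obtain ⟨C, hC, hlip⟩ := exists_lipschitz_of_contDiff (contDiff_gradXi hL.contDiff) ρ T R
  refine ⟨(C + 1) / m, by positivity, fun x y s r p p' q q' hx hy hs hr hq hq' => ?_⟩
  have h1 := hq.2 q' hq'.1
  have h2 := hq'.2 q hq.1
  have h3 := hmono x s q q' hx hs hq.1 hq'.1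
  have h4 := hlip y x r s q' q' hy hx hr hs hq'.1 hq'.1
  simp only [sub_self, norm_zero, add_zero] at h4
  rw [norm_sub_rev y x, abs_sub_comm r s] at h4
  -- Each variational inequality is tested with the other solution and the two are added. Strong
  -- monotonicity bounds the left side below.
  have h5 : ⟪gradXi L x s q - gradXi L x s q', q - q'⟫ ≤
      ⟪(gradXi L y r q' - gradXi L x s q') + (p - p'), q - q'⟫ := by
    rw [← neg_sub q q', inner_neg_right] at h1
    simp only [inner_sub_left, inner_add_left] at h1 h2 ⊢
    linarith
  have h6 := h5.trans (real_inner_le_norm _ _)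
  have h7 := norm_add_le (gradXi L y r q' - gradXi L x s q') (p - p')
  have h8 : m * ‖q - q'‖ ^ 2 ≤ (C * (‖x - y‖ + |s - r|) + ‖p - p'‖) * ‖q - q'‖ := by
    refine h3.trans (h6.trans (mul_le_mul_of_nonneg_right (h7.trans ?_) (norm_nonneg _)))
    linarith
  rcases (norm_nonneg (q - q')).eq_or_lt with h0 | h0
  · rw [← h0]; positivity
  have h9 : m * ‖q - q'‖ ≤ C * (‖x - y‖ + |s - r|) + ‖p - p'‖ := by
    refine le_of_mul_le_mul_right ?_ h0
    linarith
  have h10 : C * (‖x - y‖ + |s - r|) + ‖p - p'‖ ≤ (C + 1) * (‖x - y‖ + |s - r| + ‖p - p'‖) := by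
    nlinarith [norm_nonneg (x - y), abs_nonneg (s - r), norm_nonneg (p - p'),
      mul_nonneg hC (norm_nonneg (p - p'))]
  rw [div_mul_eq_mul_div, le_div_iff₀ hm]
  linarith

theorem IsConstrainedVelocity.mono_radius {R R' : ℝ} {x : Space d} {s : ℝ} {p q : Space d}
    (h : IsConstrainedVelocity L R x s p q) (hR : R' ≤ R) (hq : ‖q‖ ≤ R') :
    IsConstrainedVelocity L R' x s p q :=
  ⟨hq, fun w hw => h.2 w (hw.trans hR)⟩

/-- In the interior of the ball every direction is allowed, so the constrained velocity is the true
Legendre transform of the momentum. The test point moves from q against the residual by the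
remaining distance R − ‖q‖. -/
theorem IsConstrainedVelocity.gradXi_eq {R : ℝ} {x : Space d} {s : ℝ} {p q : Space d}
    (h : IsConstrainedVelocity L R x s p q) (hq : ‖q‖ < R) : gradXi L x s q = p := by
  set g := gradXi L x s q - p with hg
  by_contra hne
  have hg0 : g ≠ 0 := sub_ne_zero.2 hne
  have hn : 0 < ‖g‖ := norm_pos_iff.2 hg0
  have h1 := h.2 (q - ((R - ‖q‖) / ‖g‖) • g) (by
    refine (norm_sub_le _ _).trans ?_
    rw [norm_smul, Real.norm_of_nonneg (div_nonneg (by linarith) hn.le), div_mul_cancel₀ _ hn.ne']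
    linarith)
  rw [sub_sub_cancel_left, inner_neg_right, inner_smul_right, real_inner_self_eq_norm_sq] at h1
  have : 0 < (R - ‖q‖) / ‖g‖ * ‖g‖ ^ 2 := mul_pos (div_pos (by linarith) hn) (by positivity)
  linarith

theorem isConstrainedVelocity_gradXi {R : ℝ} (x : Space d) (s : ℝ) {q : Space d}
    (hq : ‖q‖ ≤ R) : IsConstrainedVelocity L R x s (gradXi L x s q) q :=
  ⟨hq, fun w _ => by simp⟩

end Calculus

/-! ### Weak compactness of bounded velocities -/

section WeakCompactness

variable {d : ℕ}

/-- Weak sequential compactness of a bounded set of velocities. -/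
theorem exists_weak_limit {t R : ℝ} (ht : 0 ≤ t) {q : ℕ → ℝ → Space d}
    (hq : ∀ n, Measurable (q n)) (hb : ∀ n s, ‖q n s‖ ≤ R) :
    ∃ φ : ℕ → ℕ, StrictMono φ ∧ ∃ q' : ℝ → Space d, Measurable q' ∧ (∀ s, ‖q' s‖ ≤ R) ∧
      ∀ g : ℝ → Space d, Measurable g → (∃ C : ℝ, ∀ s ∈ Ioc 0 t, ‖g s‖ ≤ C) →
        Filter.Tendsto (fun n => ∫ s in (0 : ℝ)..t, ⟪g s, q (φ n) s⟫) Filter.atTop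
          (𝓝 (∫ s in (0 : ℝ)..t, ⟪g s, q' s⟫)) := by
  have hR : 0 ≤ R := (norm_nonneg _).trans (hb 0 0)
  set μ : Measure ℝ := volume.restrict (Ioc 0 t) with hμ
  have hmem : ∀ g : ℝ → Space d, Measurable g → (∃ C : ℝ, ∀ s ∈ Ioc 0 t, ‖g s‖ ≤ C) →
      MemLp g 2 μ := by
    rintro g hg ⟨C, hC⟩
    exact MemLp.of_bound hg.aestronglyMeasurable C
      ((ae_restrict_iff' measurableSet_Ioc).2 (Filter.Eventually.of_forall hC))
  have hqm : ∀ n, MemLp (q n) 2 μ := fun n => hmem _ (hq n) ⟨R, fun s _ => hb n s⟩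
  set Q : ℕ → Lp (Space d) 2 μ := fun n => (hqm n).toLp (q n) with hQ
  obtain ⟨B, hB⟩ : ∃ B : ℝ, ∀ n, ‖Q n‖ ≤ B := by
    refine ⟨_, fun n => Lp.norm_le_of_ae_bound (C := R) hR ?_⟩
    filter_upwards [(hqm n).coeFn_toLp] with s hs
    rw [hQ]
    simp only
    rw [hs]
    exact hb n s
  have hball : ∀ n, StrongDual.toWeakDual (InnerProductSpace.toDual ℝ (Lp (Space d) 2 μ) (Q n)) ∈
      WeakDual.toStrongDual ⁻¹' Metric.closedBall (0 : StrongDual ℝ (Lp (Space d) 2 μ)) B := by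
    intro n
    simp only [mem_preimage, Metric.mem_closedBall, dist_zero_right]
    refine le_trans (le_of_eq ?_) (hB n)
    exact (InnerProductSpace.toDual ℝ (Lp (Space d) 2 μ)).norm_map (Q n)
  -- A finite exponent makes L² separable, which sequential weak-* compactness of balls requires.
  have : Fact ((2 : ENNReal) ≠ ⊤) := ⟨by norm_num⟩
  obtain ⟨Φ, -, φ, hφ, hlim⟩ := WeakDual.isSeqCompact_closedBall ℝ (Lp (Space d) 2 μ) 0 B hball
  set q₀ : Lp (Space d) 2 μ := (InnerProductSpace.toDual ℝ (Lp (Space d) 2 μ)).symm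
    (WeakDual.toStrongDual Φ) with hq₀
  have hweak : ∀ g : ℝ → Space d, Measurable g → (∃ C : ℝ, ∀ s ∈ Ioc 0 t, ‖g s‖ ≤ C) →
      Filter.Tendsto (fun n => ∫ s, ⟪g s, q (φ n) s⟫ ∂μ) Filter.atTop
        (𝓝 (∫ s, ⟪g s, q₀ s⟫ ∂μ)) := by
    intro g hg hgb
    have hgm := hmem g hg hgb
    have h1 := ((WeakDual.eval_continuous (hgm.toLp g)).tendsto Φ).comp hlim
    have e1 : ∀ n, ∫ s, ⟪g s, q n s⟫ ∂μ = ⟪Q n, hgm.toLp g⟫ := by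
      intro n
      rw [L2.inner_def]
      refine integral_congr_ae ?_
      filter_upwards [hgm.coeFn_toLp, (hqm n).coeFn_toLp] with s h2 h3
      rw [hQ]
      simp only
      rw [h2, h3, real_inner_comm]
    have e2 : ∫ s, ⟪g s, q₀ s⟫ ∂μ = Φ (hgm.toLp g) := by
      have : Φ (hgm.toLp g) = ⟪q₀, hgm.toLp g⟫ := by
        rw [hq₀, InnerProductSpace.toDual_symm_apply]
        rfl
      rw [this, L2.inner_def]
      refine integral_congr_ae ?_
      filter_upwards [hgm.coeFn_toLp] with s h2
      rw [h2, real_inner_comm]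
    rw [e2]
    refine h1.congr fun n => ?_
    rw [e1]
    rfl
  have hm₀ : Measurable (q₀ : ℝ → Space d) := (Lp.stronglyMeasurable q₀).measurable
  -- The bound R passes to the weak limit: testing with the unit field `u` along `q₀` on `A` gives
  -- ∫_A ‖q₀‖ ≤ ∫_A R, so `A` is null.
  set A : Set ℝ := {s | R < ‖q₀ s‖} with hA
  have hAm : MeasurableSet A := measurableSet_lt measurable_const hm₀.norm
  set u : ℝ → Space d := A.indicator fun s => ‖q₀ s‖⁻¹ • q₀ s with hu
  have hum : Measurable u := (hm₀.norm.inv.smul hm₀).indicator hAm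
  have hint : Integrable q₀ μ := (Lp.memLp q₀).integrable (by norm_num)
  have hub : ∀ s, ‖u s‖ ≤ A.indicator (fun _ => (1 : ℝ)) s := by
    intro s
    by_cases hs : s ∈ A
    · rw [hu, indicator_of_mem hs, indicator_of_mem hs, norm_smul, norm_inv, norm_norm]
      exact inv_mul_le_one
    · rw [hu, indicator_of_notMem hs, indicator_of_notMem hs, norm_zero]
  have hle : ∫ s, ⟪u s, q₀ s⟫ ∂μ ≤ ∫ s, A.indicator (fun _ => R) s ∂μ := by
    refine le_of_tendsto' (hweak u hum ⟨1, fun s _ => (hub s).trans ?_⟩) fun n => ?_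
    · exact indicator_le_self' (fun _ _ => zero_le_one) s
    · have hin : Integrable (fun s => ⟪u s, q (φ n) s⟫) μ := by
        refine Integrable.of_bound (hum.inner (hq _)).aestronglyMeasurable (1 * R)
          (Filter.Eventually.of_forall fun s => (norm_inner_le_norm _ _).trans ?_)
        exact mul_le_mul ((hub s).trans (indicator_le_self' (fun _ _ => zero_le_one) s)) (hb _ _)
          (norm_nonneg _) zero_le_one
      refine integral_mono hin ((integrable_const R).indicator hAm) fun s => ?_
      by_cases hs : s ∈ A
      · have := hub s
        rw [indicator_of_mem hs] at this ⊢
        refine (real_inner_le_norm _ _).trans ?_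
        calc ‖u s‖ * ‖q (φ n) s‖ ≤ 1 * R :=
              mul_le_mul this (hb _ _) (norm_nonneg _) zero_le_one
          _ = R := one_mul R
      · rw [hu, indicator_of_notMem hs, indicator_of_notMem hs, inner_zero_left]
  have hbd : ∀ᵐ s ∂μ, ‖q₀ s‖ ≤ R := by
    have h0 : 0 ≤ fun s => A.indicator (fun s => ‖q₀ s‖ - R) s :=
      fun s => indicator_nonneg (f := fun s => ‖q₀ s‖ - R) (fun s hs => (sub_pos.2 hs).le) s
    have hi : Integrable (fun s => A.indicator (fun s => ‖q₀ s‖ - R) s) μ :=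
      (hint.norm.sub (integrable_const R)).indicator hAm
    have hz : ∫ s, A.indicator (fun s => ‖q₀ s‖ - R) s ∂μ = 0 := by
      refine le_antisymm ?_ (integral_nonneg h0)
      have e1 : (fun s => A.indicator (fun s => ‖q₀ s‖ - R) s) =
          fun s => ⟪u s, q₀ s⟫ - A.indicator (fun _ => R) s := by
        funext s
        by_cases hs : s ∈ A
        · have hpos : 0 < ‖q₀ s‖ := hR.trans_lt hs
          rw [hu, indicator_of_mem hs, indicator_of_mem hs, indicator_of_mem hs, inner_smul_left,
            real_inner_self_eq_norm_sq]
          simp only [conj_trivial]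
          field_simp
        · rw [hu, indicator_of_notMem hs, indicator_of_notMem hs, indicator_of_notMem hs,
            inner_zero_left, sub_zero]
      have e2 : (fun s => ⟪u s, q₀ s⟫) = A.indicator fun s => ‖q₀ s‖ := by
        funext s
        by_cases hs : s ∈ A
        · have hpos : 0 < ‖q₀ s‖ := hR.trans_lt hs
          rw [hu, indicator_of_mem hs, indicator_of_mem hs, inner_smul_left,
            real_inner_self_eq_norm_sq]
          simp only [conj_trivial]
          field_simp
        · rw [hu, indicator_of_notMem hs, indicator_of_notMem hs, inner_zero_left]
      rw [e1, integral_sub (by rw [e2]; exact hint.norm.indicator hAm)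
        ((integrable_const R).indicator hAm)]
      linarith
    have := (integral_eq_zero_iff_of_nonneg h0 hi).1 hz
    filter_upwards [this] with s hs
    by_contra hlt
    have hsA : s ∈ A := not_le.1 hlt
    simp only [indicator_of_mem hsA, Pi.zero_apply] at hs
    exact hlt (by linarith)
  -- Resetting the limit on a null set makes the bound hold at every time.
  refine ⟨φ, hφ, fun s => if ‖q₀ s‖ ≤ R then q₀ s else 0, ?_, fun s => ?_, fun g hg hgb => ?_⟩
  · exact Measurable.ite (measurableSet_le hm₀.norm measurable_const) hm₀ measurable_const
  · dsimp only
    split_ifs with h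
    · exact h
    · simpa using hR
  · have h1 := hweak g hg hgb
    simp only [intervalIntegral.integral_of_le ht]
    have e : ∫ s, ⟪g s, q₀ s⟫ ∂μ =
        ∫ s, ⟪g s, (if ‖q₀ s‖ ≤ R then q₀ s else 0 : Space d)⟫ ∂μ := by
      refine integral_congr_ae ?_
      filter_upwards [hbd] with s hs
      rw [if_pos hs]
    rw [e] at h1
    exact h1

end WeakCompactness

/-! ### Direct method for controls of bounded velocity -/

section Controls

variable {d : ℕ} {L : Space d → ℝ → Space d → ℝ}

/-- The curve that starts in `y` at time `0` and has velocity `q`. -/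
noncomputable def position (y : Space d) (q : ℝ → Space d) (s : ℝ) : Space d :=
  y + ∫ r in (0 : ℝ)..s, q r

/-- The action of the curve with velocity `q` that starts in `y`. -/
noncomputable def controlAction (L : Space d → ℝ → Space d → ℝ) (t : ℝ) (y : Space d)
    (q : ℝ → Space d) : ℝ :=
  ∫ s in (0 : ℝ)..t, L (position y q s) s (q s)

/-- Measurable velocities bounded by `R` that lead from `y` to `x` in time `t`. -/
structure IsControl (R t : ℝ) (y x : Space d) (q : ℝ → Space d) : Prop where
  measurable : Measurable q
  norm_le : ∀ s, ‖q s‖ ≤ R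
  position_end : position y q t = x

theorem intervalIntegrable_of_bounded {F : Type*} [NormedAddCommGroup F]
    {q : ℝ → F} (hq : AEStronglyMeasurable q volume) {R a b : ℝ}
    (hb : ∀ s ∈ Icc a b, ‖q s‖ ≤ R) (hab : a ≤ b) : IntervalIntegrable q volume a b := by
  rw [intervalIntegrable_iff_integrableOn_Ioc_of_le hab]
  exact Measure.integrableOn_of_bounded (M := R) (by simp) hq
    ((ae_restrict_iff' measurableSet_Ioc).2
      (Filter.Eventually.of_forall fun s hs => hb s (Ioc_subset_Icc_self hs)))

theorem intervalIntegrable_of_norm_le {q : ℝ → Space d} (hq : Measurable q) {R : ℝ}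
    (hb : ∀ s, ‖q s‖ ≤ R) (a b : ℝ) : IntervalIntegrable q volume a b := by
  rcases le_total a b with h | h
  · exact intervalIntegrable_of_bounded hq.aestronglyMeasurable (fun s _ => hb s) h
  · exact (intervalIntegrable_of_bounded hq.aestronglyMeasurable (fun s _ => hb s) h).symm

theorem position_zero (y : Space d) (q : ℝ → Space d) : position y q 0 = y := by
  simp [position]

theorem position_sub {q : ℝ → Space d} (hq : Measurable q) {R : ℝ} (hb : ∀ s, ‖q s‖ ≤ R)
    (y : Space d) (r s : ℝ) : position y q s - position y q r = ∫ τ in r..s, q τ := by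
  rw [position, position, add_sub_add_left_eq_sub, intervalIntegral.integral_interval_sub_left
    (intervalIntegrable_of_norm_le hq hb _ _) (intervalIntegrable_of_norm_le hq hb _ _)]

theorem norm_position_sub_le {q : ℝ → Space d} (hq : Measurable q) {R : ℝ} (hb : ∀ s, ‖q s‖ ≤ R)
    (y : Space d) (r s : ℝ) : ‖position y q s - position y q r‖ ≤ R * |s - r| := by
  rw [position_sub hq hb]
  exact intervalIntegral.norm_integral_le_of_norm_le_const fun τ _ => hb τ

theorem continuous_position {q : ℝ → Space d} (hq : Measurable q) {R : ℝ} (hb : ∀ s, ‖q s‖ ≤ R)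
    (y : Space d) : Continuous (position y q) :=
  continuous_const.add (intervalIntegral.continuous_primitive
    (fun a b => intervalIntegrable_of_norm_le hq hb a b) 0)

theorem norm_position_le {q : ℝ → Space d} (hq : Measurable q) {R : ℝ} (hb : ∀ s, ‖q s‖ ≤ R)
    (y : Space d) {s t : ℝ} (hs : s ∈ Icc 0 t) : ‖position y q s‖ ≤ ‖y‖ + R * t := by
  have h := norm_position_sub_le hq hb y 0 s
  rw [position_zero, sub_zero, abs_of_nonneg hs.1] at h
  have h2 : ‖position y q s‖ ≤ ‖y‖ + ‖position y q s - y‖ := by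
    simpa using norm_add_le y (position y q s - y)
  have hR : 0 ≤ R := (norm_nonneg _).trans (hb 0)
  have := mul_le_mul_of_nonneg_left hs.2 hR
  linarith

theorem exists_norm_le_of_continuous {F : Type*} [NormedAddCommGroup F]
    {f : Space d × ℝ × Space d → F} (hf : Continuous f) (ρ T R : ℝ) :
    ∃ C : ℝ, ∀ x s ξ, ‖x‖ ≤ ρ → |s| ≤ T → ‖ξ‖ ≤ R → ‖f (x, s, ξ)‖ ≤ C := by
  have hKc : IsCompact (Metric.closedBall (0 : Space d) ρ ×ˢ
      (Icc (-T) T ×ˢ Metric.closedBall (0 : Space d) R)) :=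
    ((isCompact_closedBall 0 ρ).prod (isCompact_Icc.prod (isCompact_closedBall 0 R)))
  obtain ⟨C, hC⟩ := hKc.exists_bound_of_continuousOn hf.continuousOn
  exact ⟨C, fun x s ξ hx hs hξ => hC (x, s, ξ)
    ⟨by simpa using hx, abs_le.1 hs, by simpa using hξ⟩⟩

theorem intervalIntegrable_comp_curve {F : Type*} [NormedAddCommGroup F]
    {f : Space d × ℝ × Space d → F} (hf : Continuous f) {t ρ R : ℝ} (ht : 0 ≤ t)
    {γ q : ℝ → Space d} (hγ : Measurable γ) (hγb : ∀ s ∈ Icc 0 t, ‖γ s‖ ≤ ρ)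
    (hq : Measurable q) (hb : ∀ s, ‖q s‖ ≤ R) :
    IntervalIntegrable (fun s => f (γ s, s, q s)) volume 0 t := by
  obtain ⟨C, hC⟩ := exists_norm_le_of_continuous hf ρ t R
  refine intervalIntegrable_of_bounded (R := C) ?_ (fun s hs => ?_) ht
  · exact (hf.stronglyMeasurable.comp_measurable
      (hγ.prodMk (measurable_id.prodMk hq))).aestronglyMeasurable
  · exact hC _ _ _ (hγb s hs) (by rw [abs_of_nonneg hs.1]; exact hs.2) (hb s)

theorem intervalIntegrable_comp_position {F : Type*} [NormedAddCommGroup F]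
    {f : Space d × ℝ × Space d → F} (hf : Continuous f) {t R R' : ℝ} (ht : 0 ≤ t) (y : Space d)
    {q w : ℝ → Space d} (hq : Measurable q) (hb : ∀ s, ‖q s‖ ≤ R)
    (hw : Measurable w) (hwb : ∀ s, ‖w s‖ ≤ R') :
    IntervalIntegrable (fun s => f (position y q s, s, w s)) volume 0 t :=
  intervalIntegrable_comp_curve hf ht (continuous_position hq hb y).measurable
    (fun _ hs => norm_position_le hq hb y hs) hw hwb

theorem tendsto_of_forall_tendsto_inner {ι : Type*} {l : Filter ι} {u : ι → Space d} {v : Space d}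
    (h : ∀ e : Space d, Filter.Tendsto (fun i => ⟪e, u i⟫) l (𝓝 ⟪e, v⟫)) :
    Filter.Tendsto u l (𝓝 v) := by
  let b := EuclideanSpace.basisFun (Fin d) ℝ
  have e1 : u = fun i => ∑ k, ⟪b k, u i⟫ • b k := funext fun i => (b.sum_repr' (u i)).symm
  rw [e1, ← b.sum_repr' v]
  exact tendsto_finsetSum _ fun k _ => (h (b k)).smul_const (b k)

/-- This makes a component of the position at time s a pairing of the velocity with a bounded test
function on [0,t], so weak convergence of velocities gives pointwise convergence of positions. -/
theorem inner_integral_eq {q : ℝ → Space d} (hq : Measurable q) {R : ℝ} (hb : ∀ s, ‖q s‖ ≤ R)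
    {s t : ℝ} (hs : s ∈ Icc 0 t) (e : Space d) :
    ⟪e, ∫ r in (0 : ℝ)..s, q r⟫ =
      ∫ r in (0 : ℝ)..t, ⟪(Iic s).indicator (fun _ => e) r, q r⟫ := by
  have e1 : (fun r => ⟪(Iic s).indicator (fun _ => e) r, q r⟫) =
      (Iic s).indicator fun r => ⟪e, q r⟫ := by
    funext r
    by_cases hr : r ∈ Iic s
    · rw [indicator_of_mem hr, indicator_of_mem hr]
    · rw [indicator_of_notMem hr, indicator_of_notMem hr, inner_zero_left]
  rw [e1]
  refine Eq.trans ?_ (intervalIntegral.integral_indicator ⟨hs.1, hs.2⟩).symm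
  exact ((innerSL ℝ e).intervalIntegral_comp_comm (intervalIntegrable_of_norm_le hq hb 0 s)).symm

theorem isControl_const {R t : ℝ} (ht : 0 < t) {y x : Space d} (hR : ‖x - y‖ ≤ R * t) :
    IsControl R t y x fun _ => t⁻¹ • (x - y) := by
  refine ⟨measurable_const, fun s => ?_, ?_⟩
  · rw [norm_smul, norm_inv, Real.norm_of_nonneg ht.le, inv_mul_le_iff₀ ht]
    linarith
  · simp [position, smul_sub, smul_smul, ht.ne']

/-- Direct method. Superlinearity with slope 0 bounds the action below, and a minimizing sequence
converges weakly. For lower semicontinuity, the tangent inequality at the limit velocity q' bounds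
the integrand below by its value at q' plus a term linear in qₙ − q'. Replacing the position by its
limit in that linear term costs an error that vanishes by dominated convergence (`hB`); what remains
vanishes by weak convergence (`hCw`). -/
theorem IsTonelliLagrangian.exists_isControl_min (hL : IsTonelliLagrangian L) {t R : ℝ}
    (ht : 0 < t) {y x : Space d} (hR : ‖x - y‖ ≤ R * t) :
    ∃ q, IsControl R t y x q ∧
      ∀ w, IsControl R t y x w → controlAction L t y q ≤ controlAction L t y w := by
  have hc := hL.contDiff
  obtain ⟨b, hbL⟩ := hL.superlinear 0 le_rfl
  simp only [zero_mul, zero_add] at hbL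
  have hint : ∀ {q w : ℝ → Space d}, Measurable q → (∀ s, ‖q s‖ ≤ R) → Measurable w →
      (∀ s, ‖w s‖ ≤ R) → IntervalIntegrable (fun s => L (position y q s) s (w s)) volume 0 t :=
    fun hq hqb hw hwb => intervalIntegrable_comp_position
      (f := fun p : Space d × ℝ × Space d => L p.1 p.2.1 p.2.2) hc.continuous ht.le y hq hqb hw hwb
  set S : Set ℝ := controlAction L t y '' {q | IsControl R t y x q} with hS
  have hSbdd : BddBelow S := by
    refine ⟨t * b, ?_⟩
    rintro _ ⟨q, hq, rfl⟩
    have : ∫ _ in (0 : ℝ)..t, b ≤ controlAction L t y q :=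
      intervalIntegral.integral_mono_on ht.le (by simp)
        (hint hq.measurable hq.norm_le hq.measurable hq.norm_le) fun s _ => hbL _ _ _
    simpa using this
  have hSne : S.Nonempty := ⟨_, _, isControl_const ht hR, rfl⟩
  obtain ⟨u, -, hulim, huS⟩ := exists_seq_tendsto_sInf hSne hSbdd
  choose q hq hqu using huS
  obtain ⟨φ, hφ, q', hq'm, hq'b, hweak⟩ := exists_weak_limit ht.le (fun n => (hq n).measurable)
    (fun n => (hq n).norm_le)
  have hpos : ∀ s ∈ Icc 0 t, Filter.Tendsto (fun n => position y (q (φ n)) s) Filter.atTop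
      (𝓝 (position y q' s)) := by
    intro s hs
    refine Filter.Tendsto.const_add y (tendsto_of_forall_tendsto_inner fun e => ?_)
    rw [inner_integral_eq hq'm hq'b hs]
    refine (hweak ((Iic s).indicator fun _ => e) (measurable_const.indicator measurableSet_Iic)
      ⟨‖e‖, fun r _ => norm_indicator_le_norm_self _ _⟩).congr fun n => ?_
    rw [inner_integral_eq (hq _).measurable (hq _).norm_le hs]
  have hcontrol : IsControl R t y x q' := by
    refine ⟨hq'm, hq'b, ?_⟩
    refine tendsto_nhds_unique (hpos t ⟨ht.le, le_rfl⟩) ?_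
    simp only [(hq _).position_end]
    exact tendsto_const_nhds
  refine ⟨q', hcontrol, fun w hw => ?_⟩
  refine le_trans ?_ (csInf_le hSbdd ⟨w, hw, rfl⟩)
  have hgc := (contDiff_gradXi hc).continuous
  have hpm : ∀ n, Measurable (position y (q n)) := fun n =>
    (continuous_position (hq n).measurable (hq n).norm_le y).measurable
  have hp'm : Measurable (position y q') := (continuous_position hq'm hq'b y).measurable
  have htend : ∀ {F : Type} [NormedAddCommGroup F] {f : Space d × ℝ × Space d → F},
      Continuous f → ∀ s ∈ Icc 0 t, Filter.Tendsto
        (fun n => f (position y (q (φ n)) s, s, q' s)) Filter.atTop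
        (𝓝 (f (position y q' s, s, q' s))) := by
    intro F _ f hf s hs
    exact (hf.tendsto _).comp ((hpos s hs).prodMk_nhds tendsto_const_nhds)
  have hA : Filter.Tendsto (fun n => ∫ s in (0 : ℝ)..t, L (position y (q (φ n)) s) s (q' s))
      Filter.atTop (𝓝 (controlAction L t y q')) := by
    obtain ⟨C, hC⟩ := exists_norm_le_of_continuous hc.continuous (‖y‖ + R * t) t R
    refine intervalIntegral.tendsto_integral_filter_of_dominated_convergence (fun _ => C) ?_ ?_
      (by simp) ?_
    · refine Filter.Eventually.of_forall fun n => ?_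
      exact (hc.continuous.measurable.comp
        ((hpm _).prodMk (measurable_id.prodMk hq'm))).aestronglyMeasurable
    · refine Filter.Eventually.of_forall fun n => Filter.Eventually.of_forall fun s hs => ?_
      rw [uIoc_of_le ht.le] at hs
      exact hC _ _ _ (norm_position_le (hq _).measurable (hq _).norm_le y (Ioc_subset_Icc_self hs))
        (by rw [abs_of_pos hs.1]; exact hs.2) (hq'b s)
    · refine Filter.Eventually.of_forall fun s hs => ?_
      rw [uIoc_of_le ht.le] at hs
      exact htend hc.continuous s (Ioc_subset_Icc_self hs)
  have hgbound : ∃ C : ℝ, ∀ s ∈ Icc 0 t, ∀ q₁ : ℝ → Space d, Measurable q₁ → (∀ s, ‖q₁ s‖ ≤ R) →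
      ‖gradXi L (position y q₁ s) s (q' s)‖ ≤ C := by
    obtain ⟨C, hC⟩ := exists_norm_le_of_continuous hgc (‖y‖ + R * t) t R
    exact ⟨C, fun s hs q₁ h1 h2 => hC _ _ _ (norm_position_le h1 h2 y hs)
      (by rw [abs_of_nonneg hs.1]; exact hs.2) (hq'b s)⟩
  obtain ⟨C, hC⟩ := hgbound
  have hB : Filter.Tendsto (fun n => ∫ s in (0 : ℝ)..t,
      ⟪gradXi L (position y (q (φ n)) s) s (q' s) - gradXi L (position y q' s) s (q' s),
        q (φ n) s - q' s⟫) Filter.atTop (𝓝 0) := by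
    have h0 : ∫ _ in (0 : ℝ)..t, (0 : ℝ) = 0 := by simp
    suffices h : Filter.Tendsto (fun n => ∫ s in (0 : ℝ)..t,
        ⟪gradXi L (position y (q (φ n)) s) s (q' s) - gradXi L (position y q' s) s (q' s),
          q (φ n) s - q' s⟫) Filter.atTop (𝓝 (∫ _ in (0 : ℝ)..t, (0 : ℝ))) by rwa [h0] at h
    refine intervalIntegral.tendsto_integral_filter_of_dominated_convergence
      (fun _ => (C + C) * (R + R)) ?_ ?_ (by simp) ?_
    · refine Filter.Eventually.of_forall fun n => ?_
      exact (((hgc.measurable.comp ((hpm _).prodMk (measurable_id.prodMk hq'm))).sub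
        (hgc.measurable.comp (hp'm.prodMk (measurable_id.prodMk hq'm)))).inner
        ((hq _).measurable.sub hq'm)).aestronglyMeasurable
    · refine Filter.Eventually.of_forall fun n => Filter.Eventually.of_forall fun s hs => ?_
      rw [uIoc_of_le ht.le] at hs
      have h1 := hC s (Ioc_subset_Icc_self hs) _ (hq (φ n)).measurable (hq (φ n)).norm_le
      have h2 := hC s (Ioc_subset_Icc_self hs) _ hq'm hq'b
      refine (norm_inner_le_norm _ _).trans (mul_le_mul ((norm_sub_le _ _).trans (add_le_add h1 h2))
        ((norm_sub_le _ _).trans (add_le_add ((hq _).norm_le s) (hq'b s))) (norm_nonneg _) ?_)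
      linarith [(norm_nonneg _).trans h1]
    · refine Filter.Eventually.of_forall fun s hs => ?_
      rw [uIoc_of_le ht.le] at hs
      have h1 := (htend hgc s (Ioc_subset_Icc_self hs)).sub_const
        (gradXi L (position y q' s) s (q' s))
      rw [sub_self] at h1
      refine squeeze_zero_norm (a := fun n => ‖gradXi L (position y (q (φ n)) s) s (q' s) -
        gradXi L (position y q' s) s (q' s)‖ * (R + R)) (fun n => ?_) ?_
      · exact (norm_inner_le_norm _ _).trans (mul_le_mul_of_nonneg_left
          ((norm_sub_le _ _).trans (add_le_add ((hq _).norm_le s) (hq'b s))) (norm_nonneg _))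
      · simpa using h1.norm.mul_const (R + R)
  have hg'm : Measurable fun s => gradXi L (position y q' s) s (q' s) :=
    hgc.measurable.comp (hp'm.prodMk (measurable_id.prodMk hq'm))
  have hCw := hweak _ hg'm ⟨C, fun s hs => hC s (Ioc_subset_Icc_self hs) _ hq'm hq'b⟩
  have hD := (hA.add hB).add (hCw.sub_const
    (∫ s in (0 : ℝ)..t, ⟪gradXi L (position y q' s) s (q' s), q' s⟫))
  rw [sub_self, add_zero, add_zero] at hD
  refine le_of_tendsto_of_tendsto' hD (hulim.comp hφ.tendsto_atTop) fun n => ?_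
  simp only [Function.comp_apply]
  rw [← hqu (φ n)]
  have hn := hq (φ n)
  have i1 : IntervalIntegrable (fun s => ⟪gradXi L (position y q' s) s (q' s), q (φ n) s⟫)
      volume 0 t :=
    intervalIntegrable_of_bounded (R := C * R) (hg'm.inner hn.measurable).aestronglyMeasurable
      (fun s hs => (norm_inner_le_norm _ _).trans (mul_le_mul (hC s hs _ hq'm hq'b) (hn.norm_le s)
        (norm_nonneg _) ((norm_nonneg _).trans (hC s hs _ hq'm hq'b)))) ht.le
  have i2 : IntervalIntegrable (fun s => ⟪gradXi L (position y q' s) s (q' s), q' s⟫)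
      volume 0 t :=
    intervalIntegrable_of_bounded (R := C * R) (hg'm.inner hq'm).aestronglyMeasurable
      (fun s hs => (norm_inner_le_norm _ _).trans (mul_le_mul (hC s hs _ hq'm hq'b) (hq'b s)
        (norm_nonneg _) ((norm_nonneg _).trans (hC s hs _ hq'm hq'b)))) ht.le
  have i3 : IntervalIntegrable (fun s => ⟪gradXi L (position y (q (φ n)) s) s (q' s) -
      gradXi L (position y q' s) s (q' s), q (φ n) s - q' s⟫) volume 0 t := by
    refine intervalIntegrable_of_bounded (R := (C + C) * (R + R)) ?_ (fun s hs => ?_) ht.le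
    · exact (((hgc.measurable.comp ((hpm _).prodMk (measurable_id.prodMk hq'm))).sub
        hg'm).inner (hn.measurable.sub hq'm)).aestronglyMeasurable
    · have h1 := hC s hs _ hn.measurable hn.norm_le
      have h2 := hC s hs _ hq'm hq'b
      refine (norm_inner_le_norm _ _).trans (mul_le_mul ((norm_sub_le _ _).trans (add_le_add h1 h2))
        ((norm_sub_le _ _).trans (add_le_add (hn.norm_le s) (hq'b s))) (norm_nonneg _) ?_)
      linarith [(norm_nonneg _).trans h1]
  have i4 := hint hn.measurable hn.norm_le hq'm hq'b
  rw [← intervalIntegral.integral_sub i1 i2, ← intervalIntegral.integral_add i4 i3,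
    ← intervalIntegral.integral_add (i4.add i3) (i1.sub i2)]
  refine intervalIntegral.integral_mono_on ht.le ((i4.add i3).add (i1.sub i2))
    (hint hn.measurable hn.norm_le hn.measurable hn.norm_le) fun s _ => ?_
  have := hL.tangent_le (position y (q (φ n)) s) s (q' s) (q (φ n) s)
  rw [inner_sub_left, ← inner_sub_right]
  linarith

end Controls

/-! ### First variation and the multiplier for the end point -/

section FirstVariation

variable {d : ℕ} {L : Space d → ℝ → Space d → ℝ}

theorem ae_hasDerivAt_position {q : ℝ → Space d} (hq : Measurable q) {R : ℝ}
    (hb : ∀ s, ‖q s‖ ≤ R) (y : Space d) : ∀ᵐ s : ℝ, HasDerivAt (position y q) (q s) s := by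
  have hloc : LocallyIntegrable q volume := by
    refine (locallyIntegrable_const R).mono hq.aestronglyMeasurable ?_
    exact Filter.Eventually.of_forall fun s => (hb s).trans (le_abs_self R)
  filter_upwards [_root_.LocallyIntegrable.ae_hasDerivAt_integral hloc] with s hs
  exact (hs 0).const_add y

/-- Integration by parts for the primitives of two bounded measurable functions. -/
theorem integral_inner_position {a b : ℝ → Space d} (ha : Measurable a) (hb : Measurable b)
    {A B t : ℝ} (ht : 0 ≤ t) (hab : ∀ s, ‖a s‖ ≤ A) (hbb : ∀ s, ‖b s‖ ≤ B) :
    ∫ s in (0 : ℝ)..t, ⟪a s, position 0 b s⟫ =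
      ⟪position 0 a t, position 0 b t⟫ - ∫ s in (0 : ℝ)..t, ⟪position 0 a s, b s⟫ := by
  have hA : 0 ≤ A := (norm_nonneg _).trans (hab 0)
  have hB : 0 ≤ B := (norm_nonneg _).trans (hbb 0)
  have hpa : ∀ s ∈ Icc 0 t, ‖position 0 a s‖ ≤ A * t := fun s hs => by
    simpa using norm_position_le ha hab 0 hs
  have hpb : ∀ s ∈ Icc 0 t, ‖position 0 b s‖ ≤ B * t := fun s hs => by
    simpa using norm_position_le hb hbb 0 hs
  -- The primitives are only differentiable almost everywhere; their product is Lipschitz, hence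
  -- absolutely continuous, and the fundamental theorem of calculus holds for it.
  have hlip : LipschitzOnWith (Real.toNNReal (A * t * B + A * (B * t)))
      (fun s => ⟪position 0 a s, position 0 b s⟫) (uIcc 0 t) := by
    rw [uIcc_of_le ht]
    refine LipschitzOnWith.of_dist_le_mul fun s hs r hr => ?_
    rw [Real.coe_toNNReal _ (by positivity), dist_eq_norm, dist_eq_norm]
    have e : ⟪position 0 a s, position 0 b s⟫ - ⟪position 0 a r, position 0 b r⟫ =
        ⟪position 0 a s, position 0 b s - position 0 b r⟫ +
          ⟪position 0 a s - position 0 a r, position 0 b r⟫ := by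
      rw [inner_sub_left, inner_sub_right]; ring
    rw [e, add_mul]
    refine (norm_add_le _ _).trans (add_le_add ?_ ?_)
    · refine (norm_inner_le_norm _ _).trans ?_
      rw [mul_assoc]
      exact mul_le_mul (hpa s hs) (norm_position_sub_le hb hbb 0 r s) (norm_nonneg _)
        (by positivity)
    · refine (norm_inner_le_norm _ _).trans ?_
      rw [mul_right_comm]
      exact mul_le_mul (norm_position_sub_le ha hab 0 r s) (hpb r hr) (norm_nonneg _)
        (by positivity)
  have h := hlip.absolutelyContinuousOnInterval.integral_deriv_eq_sub
  have hm1 : Measurable fun s => ⟪position 0 a s, b s⟫ :=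
    (continuous_position ha hab 0).measurable.inner hb
  have hm2 : Measurable fun s => ⟪a s, position 0 b s⟫ :=
    ha.inner (continuous_position hb hbb 0).measurable
  have i1 : IntervalIntegrable (fun s => ⟪position 0 a s, b s⟫) volume 0 t :=
    intervalIntegrable_of_bounded (R := A * t * B) hm1.aestronglyMeasurable (fun s hs =>
      (norm_inner_le_norm _ _).trans (mul_le_mul (hpa s hs) (hbb s) (norm_nonneg _)
        (by positivity))) ht
  have i2 : IntervalIntegrable (fun s => ⟪a s, position 0 b s⟫) volume 0 t :=
    intervalIntegrable_of_bounded (R := A * (B * t)) hm2.aestronglyMeasurable (fun s hs =>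
      (norm_inner_le_norm _ _).trans (mul_le_mul (hab s) (hpb s hs) (norm_nonneg _) hA)) ht
  have e : ∫ s in (0 : ℝ)..t, deriv (fun s => ⟪position 0 a s, position 0 b s⟫) s =
      ∫ s in (0 : ℝ)..t, (⟪position 0 a s, b s⟫ + ⟪a s, position 0 b s⟫) := by
    refine intervalIntegral.integral_congr_ae ?_
    filter_upwards [ae_hasDerivAt_position ha hab 0,
      ae_hasDerivAt_position hb hbb 0] with s h1 h2 _
    exact (h1.inner ℝ h2).deriv
  rw [e, intervalIntegral.integral_add i1 i2, position_zero, inner_zero_left, sub_zero] at h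
  linarith

theorem position_add_smul {q h : ℝ → Space d} (hq : Measurable q) {R R' : ℝ}
    (hqb : ∀ s, ‖q s‖ ≤ R) (hh : Measurable h) (hhb : ∀ s, ‖h s‖ ≤ R') (y : Space d) (ε s : ℝ) :
    position y (fun r => q r + ε • h r) s = position y q s + ε • position 0 h s := by
  have i : IntervalIntegrable (fun r => ε • h r) volume 0 s :=
    (intervalIntegrable_of_norm_le hh hhb 0 s).smul ε
  simp only [position, zero_add]
  rw [intervalIntegral.integral_add (intervalIntegrable_of_norm_le hq hqb 0 s) i, intervalIntegral.integral_smul, add_assoc]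

/-- The first variation of the action at a minimizer over the convex set of controls. -/
theorem first_variation_nonneg
    (hL : ContDiff ℝ 2 (fun p : Space d × ℝ × Space d => L p.1 p.2.1 p.2.2)) {t R : ℝ}
    (ht : 0 ≤ t) {y x : Space d} {q w : ℝ → Space d} (hq : IsControl R t y x q)
    (hw : IsControl R t y x w)
    (hmin : ∀ w, IsControl R t y x w → controlAction L t y q ≤ controlAction L t y w) :
    0 ≤ ∫ s in (0 : ℝ)..t, (⟪gradX L (position y q s) s (q s), position 0 (fun r => w r - q r) s⟫ +
      ⟪gradXi L (position y q s) s (q s), w s - q s⟫) := by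
  have hR : 0 ≤ R := (norm_nonneg _).trans (hq.norm_le 0)
  set h : ℝ → Space d := fun r => w r - q r with hh
  have hhm : Measurable h := hw.measurable.sub hq.measurable
  have hhb : ∀ s, ‖h s‖ ≤ R + R := fun s =>
    (norm_sub_le _ _).trans (add_le_add (hw.norm_le s) (hq.norm_le s))
  have hgX := (contDiff_gradX hL).continuous
  have hgXi := (contDiff_gradXi hL).continuous
  have hγm : Measurable (position y q) :=
    (continuous_position hq.measurable hq.norm_le y).measurable
  have hhp : Measurable (position 0 h) := (continuous_position hhm hhb 0).measurable
  set F : ℝ → ℝ → ℝ := fun ε s => L (position y q s + ε • position 0 h s) s (q s + ε • h s) with hF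
  set F' : ℝ → ℝ → ℝ := fun ε s =>
    ⟪gradX L (position y q s + ε • position 0 h s) s (q s + ε • h s), position 0 h s⟫ +
      ⟪gradXi L (position y q s + ε • position 0 h s) s (q s + ε • h s), h s⟫ with hF'
  -- The radii contain positions and velocities of all perturbed curves with |ε| ≤ 1.
  obtain ⟨C₁, hC₁⟩ := exists_norm_le_of_continuous hgX
    (‖y‖ + R * t + 1 * ((R + R) * t)) t (R + 1 * (R + R))
  obtain ⟨C₂, hC₂⟩ := exists_norm_le_of_continuous hgXi
    (‖y‖ + R * t + 1 * ((R + R) * t)) t (R + 1 * (R + R))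
  have hmp : ∀ ε : ℝ, Measurable fun s =>
      (position y q s + ε • position 0 h s, s, q s + ε • h s) := fun ε =>
    (hγm.add (hhp.const_smul ε)).prodMk
      (measurable_id.prodMk (hq.measurable.add (hhm.const_smul ε)))
  have hder : HasDerivAt (fun ε => ∫ s in (0 : ℝ)..t, F ε s) (∫ s in (0 : ℝ)..t, F' 0 s) 0 := by
    refine (intervalIntegral.hasDerivAt_integral_of_dominated_loc_of_deriv_le
      (bound := fun _ => C₁ * ((R + R) * t) + C₂ * (R + R))
      (Ioo_mem_nhds (by norm_num : (-1 : ℝ) < 0) one_pos) ?_ ?_ ?_ ?_ (by simp) ?_).2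
    · exact Filter.Eventually.of_forall fun ε =>
        (hL.continuous.measurable.comp (hmp ε)).aestronglyMeasurable
    · have := intervalIntegrable_comp_position (t := t) hL.continuous ht y hq.measurable hq.norm_le
        hq.measurable hq.norm_le
      simpa [hF] using this
    · exact (((hgX.measurable.comp (hmp 0)).inner hhp).add
        ((hgXi.measurable.comp (hmp 0)).inner hhm)).aestronglyMeasurable
    · refine Filter.Eventually.of_forall fun s hs ε hε => ?_
      rw [uIoc_of_le ht] at hs
      have hε1 : |ε| ≤ 1 := (abs_lt.2 hε).le
      have hs' := Ioc_subset_Icc_self hs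
      have hb1 : ‖position 0 h s‖ ≤ (R + R) * t := by simpa using norm_position_le hhm hhb 0 hs'
      have hx : ‖position y q s + ε • position 0 h s‖ ≤ ‖y‖ + R * t + 1 * ((R + R) * t) := by
        refine (norm_add_le _ _).trans (add_le_add
          (norm_position_le hq.measurable hq.norm_le y hs') ?_)
        rw [norm_smul]
        exact mul_le_mul hε1 hb1 (norm_nonneg _) zero_le_one
      have hξ : ‖q s + ε • h s‖ ≤ R + 1 * (R + R) := by
        refine (norm_add_le _ _).trans (add_le_add (hq.norm_le s) ?_)
        rw [norm_smul]
        exact mul_le_mul hε1 (hhb s) (norm_nonneg _) zero_le_one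
      have hst : |s| ≤ t := by rw [abs_of_pos hs.1]; exact hs.2
      have h1 := hC₁ _ _ _ hx hst hξ
      have h2 := hC₂ _ _ _ hx hst hξ
      refine (norm_add_le _ _).trans (add_le_add ?_ ?_)
      · exact (norm_inner_le_norm _ _).trans (mul_le_mul h1 hb1 (norm_nonneg _)
          ((norm_nonneg _).trans h1))
      · exact (norm_inner_le_norm _ _).trans (mul_le_mul h2 (hhb s) (norm_nonneg _)
          ((norm_nonneg _).trans h2))
    · refine Filter.Eventually.of_forall fun s _ ε _ => ?_
      have hl : ∀ u v : Space d, HasDerivAt (fun ε : ℝ => u + ε • v) v ε := fun u v => by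
        simpa using ((hasDerivAt_id ε).smul_const v).const_add u
      exact hasDerivAt_lagrangian_comp hL s (hl _ _) (hl _ _)
  -- Only ε in [0,1] is admissible: there q + εh is a convex combination of q and w. So the
  -- derivative at 0 is merely nonnegative.
  have hm : IsLocalMinOn (fun ε => ∫ s in (0 : ℝ)..t, F ε s) (Icc 0 1) 0 := by
    refine IsMinOn.localize fun ε hε => ?_
    have hc : IsControl R t y x fun s => q s + ε • h s := by
      refine ⟨hq.measurable.add (hhm.const_smul ε), fun s => ?_, ?_⟩
      · have : q s + ε • h s ∈ Metric.closedBall (0 : Space d) R := by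
          refine (convex_closedBall (0 : Space d) R).segment_subset (x := q s) (y := w s)
            (by simpa using hq.norm_le s) (by simpa using hw.norm_le s) ?_
          rw [segment_eq_image']
          exact ⟨ε, hε, rfl⟩
        simpa using this
      · have e : position 0 h t = 0 := by
          have := (intervalIntegral.integral_sub
            (intervalIntegrable_of_norm_le hw.measurable hw.norm_le 0 t)
            (intervalIntegrable_of_norm_le hq.measurable hq.norm_le 0 t))
          have e1 := hw.position_end
          have e2 := hq.position_end
          rw [position] at e1 e2
          rw [position, zero_add, hh, this, sub_eq_zero]
          exact add_left_cancel (e1.trans e2.symm)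
        rw [position_add_smul hq.measurable hq.norm_le hhm hhb, e, smul_zero, add_zero,
          hq.position_end]
    have := hmin _ hc
    simp only [controlAction, position_add_smul hq.measurable hq.norm_le hhm hhb] at this
    simpa [hF] using this
  have := hm.hasFDerivWithinAt_nonneg (y := 1) hder.hasFDerivAt.hasFDerivWithinAt
    (mem_posTangentConeAt_of_segment_subset (by rw [zero_add, segment_eq_Icc zero_le_one]))
  simpa [hF'] using this

/-- Lagrange multiplier for a linear functional on the velocities bounded by `R` with prescribed
integral. -/
theorem exists_multiplier {t R M : ℝ} (ht : 0 < t) {m q : ℝ → Space d} (hm : Measurable m)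
    (hmb : ∀ s ∈ Icc 0 t, ‖m s‖ ≤ M) (hq : Measurable q) (hqb : ∀ s, ‖q s‖ ≤ R)
    (hint : ‖∫ s in (0 : ℝ)..t, q s‖ < R * t)
    (hmin : ∀ w : ℝ → Space d, Measurable w → (∀ s, ‖w s‖ ≤ R) →
      ∫ s in (0 : ℝ)..t, w s = ∫ s in (0 : ℝ)..t, q s → 0 ≤ ∫ s in (0 : ℝ)..t, ⟪m s, w s - q s⟫) :
    ∃ c : Space d, ∀ w : ℝ → Space d, Measurable w → (∀ s, ‖w s‖ ≤ R) →
      0 ≤ ∫ s in (0 : ℝ)..t, ⟪m s - c, w s - q s⟫ := by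
  have hR : 0 ≤ R := (norm_nonneg _).trans (hqb 0)
  have hM : 0 ≤ M := (norm_nonneg _).trans (hmb 0 ⟨le_rfl, ht.le⟩)
  have hi : ∀ w : ℝ → Space d, Measurable w → (∀ s, ‖w s‖ ≤ R) →
      IntervalIntegrable (fun s => w s - q s) volume 0 t := fun w hw hwb =>
    (intervalIntegrable_of_norm_le hw hwb 0 t).sub (intervalIntegrable_of_norm_le hq hqb 0 t)
  have hbd : ∀ w : ℝ → Space d, (∀ s, ‖w s‖ ≤ R) → ∀ s ∈ Icc 0 t,
      ‖⟪m s, w s - q s⟫‖ ≤ M * (R + R) := fun w hwb s hs =>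
    (norm_inner_le_norm _ _).trans (mul_le_mul (hmb s hs)
      ((norm_sub_le _ _).trans (add_le_add (hwb s) (hqb s))) (norm_nonneg _) hM)
  have him : ∀ w : ℝ → Space d, Measurable w → (∀ s, ‖w s‖ ≤ R) →
      IntervalIntegrable (fun s => ⟪m s, w s - q s⟫) volume 0 t := fun w hw hwb =>
    intervalIntegrable_of_bounded (hm.inner (hw.sub hq)).aestronglyMeasurable (hbd w hwb) ht.le
  -- Pairs of an end point displacement and a level strictly above the linear cost of a control
  -- achieving it. Minimality of q says exactly that this convex set misses the origin.
  set S : Set (Space d × ℝ) := {z | ∃ w : ℝ → Space d, Measurable w ∧ (∀ s, ‖w s‖ ≤ R) ∧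
    z.1 = (∫ s in (0 : ℝ)..t, (w s - q s)) ∧ (∫ s in (0 : ℝ)..t, ⟪m s, w s - q s⟫) < z.2} with hS
  have hconv : Convex ℝ S := by
    rintro z ⟨w, hw, hwb, hz1, hz2⟩ z' ⟨w', hw', hwb', hz1', hz2'⟩ a b ha hb hab
    have e : ∀ s, a • w s + b • w' s - q s = a • (w s - q s) + b • (w' s - q s) := fun s => by
      have : q s = (a + b) • q s := by rw [hab, one_smul]
      conv_lhs => rw [this]
      module
    refine ⟨fun s => a • w s + b • w' s, (hw.const_smul a).add (hw'.const_smul b), fun s => ?_,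
      ?_, ?_⟩
    · have := (convex_closedBall (0 : Space d) R) (x := w s) (by simpa using hwb s)
        (y := w' s) (by simpa using hwb' s) ha hb hab
      simpa using this
    · simp only [e]
      have i1 : IntervalIntegrable (fun s => a • (w s - q s)) volume 0 t := (hi w hw hwb).smul a
      have i2 : IntervalIntegrable (fun s => b • (w' s - q s)) volume 0 t :=
        (hi w' hw' hwb').smul b
      rw [intervalIntegral.integral_add i1 i2,
        intervalIntegral.integral_smul, intervalIntegral.integral_smul, ← hz1, ← hz1']
      rfl
    · simp only [e, inner_add_right, inner_smul_right]
      rw [intervalIntegral.integral_add ((him w hw hwb).const_mul a)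
        ((him w' hw' hwb').const_mul b), intervalIntegral.integral_const_mul,
        intervalIntegral.integral_const_mul]
      change _ < a * z.2 + b * z'.2
      rcases ha.eq_or_lt with h0 | h0
      · have hb1 : b = 1 := by rw [← h0, zero_add] at hab; exact hab
        rw [← h0, hb1]
        linarith
      · have h1 := mul_lt_mul_of_pos_left hz2 h0
        have h2 := mul_le_mul_of_nonneg_left hz2'.le hb
        linarith
  have h0S : (0 : Space d × ℝ) ∉ S := by
    rintro ⟨w, hw, hwb, hz1, hz2⟩
    have h1 := hmin w hw hwb (by
      rw [intervalIntegral.integral_sub (intervalIntegrable_of_norm_le hw hwb 0 t)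
        (intervalIntegrable_of_norm_le hq hqb 0 t)] at hz1
      exact sub_eq_zero.1 hz1.symm)
    exact absurd hz2 (not_lt.2 h1)
  set N := M * (R + R) * |t - 0| with hN
  have hNn : 0 ≤ N := by positivity
  -- `S` has interior points: constant velocities realize all these displacements at cost at most
  -- `N`. The strict inequality `hint` puts displacement 0 among them.
  set U : Set (Space d × ℝ) := {z | ‖z.1 + ∫ s in (0 : ℝ)..t, q s‖ < R * t ∧ N < z.2} with hU
  have hUo : IsOpen U := by
    have h1 : Continuous fun z : Space d × ℝ => ‖z.1 + ∫ s in (0 : ℝ)..t, q s‖ := by fun_prop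
    exact (isOpen_lt h1 continuous_const).inter (isOpen_lt continuous_const continuous_snd)
  have hUS : U ⊆ S := by
    rintro z ⟨hz1, hz2⟩
    have hwb : ‖t⁻¹ • (z.1 + ∫ s in (0 : ℝ)..t, q s)‖ ≤ R := by
      rw [norm_smul, norm_inv, Real.norm_of_nonneg ht.le, inv_mul_le_iff₀ ht]
      linarith
    refine ⟨fun _ => t⁻¹ • (z.1 + ∫ s in (0 : ℝ)..t, q s), measurable_const, fun _ => hwb, ?_, ?_⟩
    · rw [intervalIntegral.integral_sub (by simp) (intervalIntegrable_of_norm_le hq hqb 0 t),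
        intervalIntegral.integral_const, sub_zero, smul_smul, mul_inv_cancel₀ ht.ne', one_smul,
        add_sub_cancel_right]
    · refine lt_of_le_of_lt ((le_abs_self _).trans ?_) hz2
      rw [← Real.norm_eq_abs]
      refine intervalIntegral.norm_integral_le_of_norm_le_const fun s hs => ?_
      rw [uIoc_of_le ht.le] at hs
      exact hbd _ (fun _ => hwb) s (Ioc_subset_Icc_self hs)
  have hzU : ((0 : Space d), N + 1) ∈ U := ⟨by simpa using hint, by simp⟩
  have hUi : U ⊆ interior S := interior_maximal hUS hUo
  obtain ⟨f, hf⟩ := geometric_hahn_banach_point_open hconv.interior isOpen_interior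
    (fun h => h0S (interior_subset h))
  rw [map_zero] at hf
  have hfS : ∀ z ∈ S, 0 ≤ f z := by
    intro z hz
    have hcl : z ∈ closure (interior S) := by
      rw [hconv.closure_interior_eq_closure_of_nonempty_interior ⟨_, hUi hzU⟩]
      exact subset_closure hz
    exact closure_minimal (fun x hx => (hf x hx).le) (isClosed_Ici.preimage f.continuous) hcl
  set β : ℝ := f (0, 1) with hβ
  set g : Space d →L[ℝ] ℝ := f.comp (ContinuousLinearMap.inl ℝ (Space d) ℝ) with hg
  have hfeq : ∀ e r, f (e, r) = g e + β * r := by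
    intro e r
    have : ((e, r) : Space d × ℝ) = (e, 0) + r • (0, 1) := by simp
    rw [this, map_add, map_smul, smul_eq_mul, mul_comm]
    rfl
  -- The separating hyperplane is not vertical, since (0, N + 1) is interior to `S`; so the
  -- functional can be normalized.
  have hβpos : 0 < β := by
    have h1 := hf _ (hUi hzU)
    rw [hfeq, map_zero, zero_add] at h1
    exact pos_of_mul_pos_left h1 (by linarith)
  set c₀ : Space d := (InnerProductSpace.toDual ℝ (Space d)).symm g with hc₀
  refine ⟨-(β⁻¹ • c₀), fun w hw hwb => ?_⟩
  have h1 : 0 ≤ g (∫ s in (0 : ℝ)..t, (w s - q s)) +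
      β * ∫ s in (0 : ℝ)..t, ⟪m s, w s - q s⟫ := by
    -- `S` contains only levels strictly above the cost, so the cost itself is reached in the limit
    -- ε → 0.
    refine le_of_forall_pos_le_add fun ε hε => ?_
    have h2 := hfS (∫ s in (0 : ℝ)..t, (w s - q s),
      (∫ s in (0 : ℝ)..t, ⟪m s, w s - q s⟫) + ε / β) ⟨w, hw, hwb, rfl, by
        have := div_pos hε hβpos
        simp only
        linarith⟩
    rw [hfeq, mul_add, mul_div_cancel₀ _ hβpos.ne'] at h2
    linarith
  have e1 : g (∫ s in (0 : ℝ)..t, (w s - q s)) = ∫ s in (0 : ℝ)..t, ⟪c₀, w s - q s⟫ := by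
    rw [← g.intervalIntegral_comp_comm (hi w hw hwb)]
    refine intervalIntegral.integral_congr fun s _ => ?_
    simp only [hc₀]
    rw [InnerProductSpace.toDual_symm_apply]
  have i1 : IntervalIntegrable (fun s => ⟪c₀, w s - q s⟫) volume 0 t :=
    ((innerSL ℝ c₀).integrable_comp (hi w hw hwb).1 |> fun h => ⟨h, by simp [ht.le]⟩)
  have e2 : (fun s => ⟪m s - -(β⁻¹ • c₀), w s - q s⟫) =
      fun s => ⟪m s, w s - q s⟫ + β⁻¹ * ⟪c₀, w s - q s⟫ := by
    funext s
    rw [sub_neg_eq_add, inner_add_left, inner_smul_left]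
    rfl
  rw [e2, intervalIntegral.integral_add (him w hw hwb) (i1.const_mul _),
    intervalIntegral.integral_const_mul, ← e1]
  have h3 := mul_nonneg (inv_nonneg.2 hβpos.le) h1
  rw [mul_add, inv_mul_cancel_left₀ hβpos.ne'] at h3
  linarith

end FirstVariation

/-! ### Maximum principle and continuity of the minimizing control -/

section ConstrainedExtremals

variable {d : ℕ} {L : Space d → ℝ → Space d → ℝ}

/-- A curve `γ` with velocity `q` and momentum `p` that solves, on `I`, the Hamiltonian system of
the Lagrangian `L` restricted to velocities of norm at most `R`. -/
structure IsConstrainedExtremal (L : Space d → ℝ → Space d → ℝ) (R : ℝ) (I : Set ℝ)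
    (γ q p : ℝ → Space d) : Prop where
  continuous_velocity : Continuous q
  hasDerivAt_curve : ∀ s, HasDerivAt γ (q s) s
  hasDerivAt_momentum : ∀ s, HasDerivAt p (gradX L (γ s) s (q s)) s
  isConstrainedVelocity : ∀ s ∈ I, IsConstrainedVelocity L R (γ s) s (p s) (q s)

/-- The maximum principle: a minimizing control is, almost everywhere, the constrained velocity
belonging to its momentum. -/
theorem exists_momentum_of_min
    (hL : ContDiff ℝ 2 (fun p : Space d × ℝ × Space d => L p.1 p.2.1 p.2.2)) {t R : ℝ}
    (ht : 0 < t) {y x : Space d} (hR : ‖x - y‖ < R * t) {q : ℝ → Space d}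
    (hq : IsControl R t y x q)
    (hmin : ∀ w, IsControl R t y x w → controlAction L t y q ≤ controlAction L t y w) :
    ∃ p : ℝ → Space d, Continuous p ∧
      (∃ c, ∀ s ∈ Icc 0 t, p s = c + ∫ r in (0 : ℝ)..s, gradX L (position y q r) r (q r)) ∧
      ∀ᵐ s, s ∈ Ioc 0 t → IsConstrainedVelocity L R (position y q s) s (p s) (q s) := by
  have hR0 : 0 ≤ R := (norm_nonneg _).trans (hq.norm_le 0)
  have hgX := (contDiff_gradX hL).continuous
  have hgXi := (contDiff_gradXi hL).continuous
  have hγm : Measurable (position y q) :=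
    (continuous_position hq.measurable hq.norm_le y).measurable
  have hz : Measurable fun s => (position y q s, s, q s) :=
    hγm.prodMk (measurable_id.prodMk hq.measurable)
  obtain ⟨C₁, hC₁⟩ := exists_norm_le_of_continuous hgX (‖y‖ + R * t) t R
  obtain ⟨C₂, hC₂⟩ := exists_norm_le_of_continuous hgXi (‖y‖ + R * t) t R
  have hb₁ : ∀ s ∈ Icc 0 t, ‖gradX L (position y q s) s (q s)‖ ≤ C₁ := fun s hs =>
    hC₁ _ _ _ (norm_position_le hq.measurable hq.norm_le y hs)
      (by rw [abs_of_nonneg hs.1]; exact hs.2) (hq.norm_le s)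
  have hb₂ : ∀ s ∈ Icc 0 t, ‖gradXi L (position y q s) s (q s)‖ ≤ C₂ := fun s hs =>
    hC₂ _ _ _ (norm_position_le hq.measurable hq.norm_le y hs)
      (by rw [abs_of_nonneg hs.1]; exact hs.2) (hq.norm_le s)
  have h0mem : (0 : ℝ) ∈ Icc 0 t := ⟨le_rfl, ht.le⟩
  have hC₁0 : 0 ≤ C₁ := (norm_nonneg _).trans (hb₁ 0 h0mem)
  -- Cut off outside [0,t], where no bound on the position is available.
  set a : ℝ → Space d := (Icc 0 t).indicator fun s => gradX L (position y q s) s (q s) with ha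
  have ham : Measurable a := (hgX.measurable.comp hz).indicator measurableSet_Icc
  have hab : ∀ s, ‖a s‖ ≤ C₁ := by
    intro s
    by_cases hs : s ∈ Icc 0 t
    · rw [ha, indicator_of_mem hs]
      exact hb₁ s hs
    · rw [ha, indicator_of_notMem hs, norm_zero]
      exact hC₁0
  set P : ℝ → Space d := position 0 a with hP
  have hPc : Continuous P := continuous_position ham hab 0
  have hPb : ∀ s ∈ Icc 0 t, ‖P s‖ ≤ C₁ * t := fun s hs => by
    simpa using norm_position_le ham hab 0 hs
  -- Integration by parts moves the variation of the position onto that of the velocity; the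
  -- boundary term vanishes because the end point is fixed.
  set m : ℝ → Space d := fun s => gradXi L (position y q s) s (q s) - P s with hm
  have hmm : Measurable m := (hgXi.measurable.comp hz).sub hPc.measurable
  have hmb : ∀ s ∈ Icc 0 t, ‖m s‖ ≤ C₂ + C₁ * t := fun s hs =>
    (norm_sub_le _ _).trans (add_le_add (hb₂ s hs) (hPb s hs))
  have hqint : ∫ s in (0 : ℝ)..t, q s = x - y := by
    have := hq.position_end
    rw [position] at this
    rw [← this, add_sub_cancel_left]
  obtain ⟨c, hc⟩ := exists_multiplier ht hmm hmb hq.measurable hq.norm_le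
    (by rw [hqint]; exact hR) (by
      intro w hw hwb hwint
      have hwc : IsControl R t y x w := ⟨hw, hwb, by rw [position, hwint, hqint]; abel⟩
      have h1 := first_variation_nonneg hL ht.le hq hwc hmin
      set h : ℝ → Space d := fun r => w r - q r with hh
      have hhm : Measurable h := hw.sub hq.measurable
      have hhb : ∀ s, ‖h s‖ ≤ R + R := fun s =>
        (norm_sub_le _ _).trans (add_le_add (hwb s) (hq.norm_le s))
      have hht : position 0 h t = 0 := by
        rw [position, zero_add, hh, intervalIntegral.integral_sub
          (intervalIntegrable_of_norm_le hw hwb 0 t)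
          (intervalIntegrable_of_norm_le hq.measurable hq.norm_le 0 t), hwint, sub_self]
      have hparts := integral_inner_position ham hhm ht.le hab hhb
      rw [hht, inner_zero_right, zero_sub] at hparts
      have hhp : ∀ s ∈ Icc 0 t, ‖position 0 h s‖ ≤ (R + R) * t := fun s hs => by
        simpa using norm_position_le hhm hhb 0 hs
      have i1 : IntervalIntegrable (fun s => ⟪a s, position 0 h s⟫) volume 0 t :=
        intervalIntegrable_of_bounded (R := C₁ * ((R + R) * t))
          (ham.inner (continuous_position hhm hhb 0).measurable).aestronglyMeasurable
          (fun s hs => (norm_inner_le_norm _ _).trans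
            (mul_le_mul (hab s) (hhp s hs) (norm_nonneg _) hC₁0)) ht.le
      have i2 : IntervalIntegrable (fun s => ⟪gradXi L (position y q s) s (q s), h s⟫)
          volume 0 t :=
        intervalIntegrable_of_bounded (R := C₂ * (R + R))
          ((hgXi.measurable.comp hz).inner hhm).aestronglyMeasurable
          (fun s hs => (norm_inner_le_norm _ _).trans
            (mul_le_mul (hb₂ s hs) (hhb s) (norm_nonneg _)
              ((norm_nonneg _).trans (hb₂ s hs)))) ht.le
      have i3 : IntervalIntegrable (fun s => ⟪P s, h s⟫) volume 0 t :=
        intervalIntegrable_of_bounded (R := C₁ * t * (R + R))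
          (hPc.measurable.inner hhm).aestronglyMeasurable
          (fun s hs => (norm_inner_le_norm _ _).trans
            (mul_le_mul (hPb s hs) (hhb s) (norm_nonneg _) (by positivity))) ht.le
      have e1 : ∫ s in (0 : ℝ)..t, (⟪gradX L (position y q s) s (q s), position 0 h s⟫ +
          ⟪gradXi L (position y q s) s (q s), h s⟫) =
          ∫ s in (0 : ℝ)..t, (⟪a s, position 0 h s⟫ +
            ⟪gradXi L (position y q s) s (q s), h s⟫) := by
        refine intervalIntegral.integral_congr fun s hs => ?_
        rw [uIcc_of_le ht.le] at hs
        simp only [ha, indicator_of_mem hs]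
      rw [e1, intervalIntegral.integral_add i1 i2, hparts] at h1
      simp only [hm, inner_sub_left]
      rw [intervalIntegral.integral_sub i2 i3]
      linarith)
  refine ⟨fun s => c + P s, continuous_const.add hPc, ⟨c, fun s hs => ?_⟩, ?_⟩
  · simp only [hP, position, zero_add]
    congr 1
    refine intervalIntegral.integral_congr fun r hr => ?_
    rw [uIcc_of_le hs.1] at hr
    have hrt : r ∈ Icc 0 t := ⟨hr.1, hr.2.trans hs.2⟩
    exact indicator_of_mem hrt _
  set n : ℝ → Space d := fun s => m s - c with hn
  have hnm : Measurable n := hmm.sub measurable_const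
  have hnb : ∀ s ∈ Icc 0 t, ‖n s‖ ≤ C₂ + C₁ * t + ‖c‖ := fun s hs =>
    (norm_sub_le _ _).trans (add_le_add (hmb s hs) le_rfl)
  -- This velocity minimizes ⟨n(s), ·⟩ over the ball at each s (it is 0 where n(s) = 0). The
  -- integral inequality for it forces q to attain the same minimum almost everywhere.
  set w : ℝ → Space d := fun s => -((R * ‖n s‖⁻¹) • n s) with hw
  have hwm : Measurable w := ((measurable_const.mul hnm.norm.inv).smul hnm).neg
  have hwb : ∀ s, ‖w s‖ ≤ R := by
    intro s
    rw [hw]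
    simp only
    rw [norm_neg, norm_smul, Real.norm_of_nonneg (by positivity), mul_assoc]
    exact mul_le_of_le_one_right hR0 inv_mul_le_one
  have hinner : ∀ s, ⟪n s, w s⟫ = -(R * ‖n s‖) := by
    intro s
    rw [hw]
    simp only
    rw [inner_neg_right, inner_smul_right, real_inner_self_eq_norm_sq]
    rcases eq_or_ne ‖n s‖ 0 with h0 | h0
    · simp [h0]
    · field_simp
  have hle : ∀ s, ∀ v : Space d, ‖v‖ ≤ R → ⟪n s, w s⟫ ≤ ⟪n s, v⟫ := by
    intro s v hv
    rw [hinner]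
    have h1 := (abs_le.1 (abs_real_inner_le_norm (n s) v)).1
    have h2 := mul_le_mul_of_nonneg_left hv (norm_nonneg (n s))
    linarith
  have hint0 := hc w hwm hwb
  have hzero : ∀ᵐ s, s ∈ Ioc 0 t → ⟪n s, w s - q s⟫ = 0 := by
    have hii : IntervalIntegrable (fun s => -⟪n s, w s - q s⟫) volume 0 t := by
      refine intervalIntegrable_of_bounded (R := (C₂ + C₁ * t + ‖c‖) * (R + R))
        (hnm.inner (hwm.sub hq.measurable)).neg.aestronglyMeasurable (fun s hs => ?_) ht.le
      rw [Pi.neg_apply, norm_neg]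
      exact (norm_inner_le_norm _ _).trans (mul_le_mul (hnb s hs)
        ((norm_sub_le _ _).trans (add_le_add (hwb s) (hq.norm_le s))) (norm_nonneg _)
        ((norm_nonneg _).trans (hnb s hs)))
    have hnn : ∀ s, 0 ≤ -⟪n s, w s - q s⟫ := by
      intro s
      rw [inner_sub_right]
      linarith [hle s (q s) (hq.norm_le s)]
    have h0 : ∫ s in Ioc 0 t, -⟪n s, w s - q s⟫ = 0 := by
      rw [← intervalIntegral.integral_of_le ht.le]
      refine le_antisymm ?_ (intervalIntegral.integral_nonneg ht.le fun s _ => hnn s)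
      rw [intervalIntegral.integral_neg]
      linarith
    have h1 := (integral_eq_zero_iff_of_nonneg (μ := volume.restrict (Ioc 0 t)) hnn hii.1).1 h0
    rw [Filter.EventuallyEq, ae_restrict_iff' measurableSet_Ioc] at h1
    filter_upwards [h1] with s hs hs'
    have := hs hs'
    simp only [Pi.zero_apply] at this
    linarith
  filter_upwards [hzero] with s hs hs'
  refine ⟨hq.norm_le s, fun v hv => ?_⟩
  have h1 := hs hs'
  have h2 := hle s v hv
  have e : gradXi L (position y q s) s (q s) - (c + P s) = n s := by
    rw [hn, hm]
    simp only
    abel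
  rw [e, inner_sub_right]
  rw [inner_sub_right] at h1
  linarith

/-- There is a minimizing control that is continuous and satisfies the maximum principle
everywhere. -/
theorem IsTonelliLagrangian.exists_constrainedExtremal_min (hL : IsTonelliLagrangian L) {t R : ℝ}
    (ht : 0 < t) {y x : Space d} (hR : ‖x - y‖ < R * t) :
    ∃ q p : ℝ → Space d, IsControl R t y x q ∧
      (∀ w, IsControl R t y x w → controlAction L t y q ≤ controlAction L t y w) ∧
      IsConstrainedExtremal L R (Icc 0 t) (position y q) q p := by
  have hc := hL.contDiff
  obtain ⟨q₀, hq₀, hmin⟩ := hL.exists_isControl_min ht hR.le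
  have hR0 : 0 ≤ R := (norm_nonneg _).trans (hq₀.norm_le 0)
  obtain ⟨p₀, hp₀c, ⟨c, hp₀⟩, hvel⟩ := exists_momentum_of_min hc ht hR hq₀ hmin
  -- Solving for the velocity at every time gives a continuous representative; uniqueness of
  -- constrained velocities makes it agree with `q₀` almost everywhere on (0,t].
  choose q hq using fun s => exists_isConstrainedVelocity hc hR0 (position y q₀ s) s (p₀ s)
  have hγc : Continuous (position y q₀) := continuous_position hq₀.measurable hq₀.norm_le y
  have hqc : Continuous q := by
    rw [continuous_iff_continuousAt]
    intro s₀
    obtain ⟨C, hC, hlip⟩ := hL.exists_constrainedVelocity_lipschitz (‖position y q₀ s₀‖ + 1)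
      (|s₀| + 1) R
    rw [ContinuousAt, tendsto_iff_norm_sub_tendsto_zero]
    have h0 : Filter.Tendsto (fun s => C * (‖position y q₀ s - position y q₀ s₀‖ + |s - s₀| +
        ‖p₀ s - p₀ s₀‖)) (𝓝 s₀) (𝓝 0) := by
      have : Continuous fun s => C * (‖position y q₀ s - position y q₀ s₀‖ + |s - s₀| +
        ‖p₀ s - p₀ s₀‖) := by fun_prop
      simpa using this.tendsto s₀
    refine squeeze_zero' (Filter.Eventually.of_forall fun s => norm_nonneg _) ?_ h0
    have h1 : ∀ᶠ s in 𝓝 s₀, ‖position y q₀ s‖ < ‖position y q₀ s₀‖ + 1 :=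
      hγc.norm.continuousAt.eventually_lt continuousAt_const (by simp)
    have h2 : ∀ᶠ s in 𝓝 s₀, |s| < |s₀| + 1 :=
      continuous_abs.continuousAt.eventually_lt continuousAt_const (by simp)
    filter_upwards [h1, h2] with s h1 h2
    exact hlip _ _ _ _ _ _ _ _ h1.le (by simp) h2.le (by simp) (hq s) (hq s₀)
  have hqb : ∀ s, ‖q s‖ ≤ R := fun s => (hq s).1
  have hae : ∀ᵐ s, s ∈ Ioc 0 t → q₀ s = q s := by
    filter_upwards [hvel] with s hs hs'
    obtain ⟨C, hC, hlip⟩ := hL.exists_constrainedVelocity_lipschitz ‖position y q₀ s‖ |s| R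
    have := hlip _ _ _ _ _ _ _ _ le_rfl le_rfl le_rfl le_rfl (hs hs') (hq s)
    simp only [sub_self, norm_zero, abs_zero, add_zero, mul_zero] at this
    exact sub_eq_zero.1 (norm_le_zero_iff.1 this)
  have hpos : ∀ s ∈ Icc 0 t, position y q s = position y q₀ s := by
    intro s hs
    rw [position, position]
    congr 1
    refine intervalIntegral.integral_congr_ae ?_
    filter_upwards [hae] with r hr hr'
    rw [uIoc_of_le hs.1] at hr'
    exact (hr ⟨hr'.1, hr'.2.trans hs.2⟩).symm
  have hact : controlAction L t y q = controlAction L t y q₀ := by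
    refine intervalIntegral.integral_congr_ae ?_
    filter_upwards [hae] with r hr hr'
    rw [uIoc_of_le ht.le] at hr'
    rw [hr hr', hpos r (Ioc_subset_Icc_self hr')]
  have hγq : Continuous (position y q) := continuous_position hqc.measurable hqb y
  have hgc : Continuous fun s => gradX L (position y q s) s (q s) :=
    (contDiff_gradX hc).continuous.comp (hγq.prodMk (continuous_id.prodMk hqc))
  refine ⟨q, fun s => c + ∫ r in (0 : ℝ)..s, gradX L (position y q r) r (q r),
    ⟨hqc.measurable, hqb, ?_⟩, fun w hw => hact.trans_le (hmin w hw), hqc, fun s => ?_, fun s => ?_,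
    fun s hs => ?_⟩
  · rw [hpos t ⟨ht.le, le_rfl⟩, hq₀.position_end]
  · exact (hqc.integral_hasStrictDerivAt 0 s).hasDerivAt.const_add y
  · exact (hgc.integral_hasStrictDerivAt 0 s).hasDerivAt.const_add c
  · have e : c + ∫ r in (0 : ℝ)..s, gradX L (position y q r) r (q r) = p₀ s := by
      rw [hp₀ s hs]
      congr 1
      refine intervalIntegral.integral_congr_ae ?_
      filter_upwards [hae] with r hr hr'
      rw [uIoc_of_le hs.1] at hr'
      have hr'' : r ∈ Ioc 0 t := ⟨hr'.1, hr'.2.trans hs.2⟩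
      rw [hr hr'', hpos r (Ioc_subset_Icc_self hr'')]
    rw [e, hpos s hs]
    exact hq s

end ConstrainedExtremals

/-! ### Continuous dependence of constrained extremals -/

section Comparison

variable {d : ℕ} {L : Space d → ℝ → Space d → ℝ}

/-- Grönwall's inequality in both time directions. -/
theorem norm_le_mul_exp_of_norm_deriv_le {F : Type*} [NormedAddCommGroup F] [NormedSpace ℝ F]
    {f f' : ℝ → F} {K a b : ℝ} (hf : ∀ s, HasDerivAt f (f' s) s)
    (hK : ∀ s ∈ uIcc a b, ‖f' s‖ ≤ K * ‖f s‖) : ‖f b‖ ≤ ‖f a‖ * Real.exp (K * |b - a|) := by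
  have key : ∀ (f f' : ℝ → F) (a b : ℝ), a ≤ b → (∀ s, HasDerivAt f (f' s) s) →
      (∀ s ∈ Icc a b, ‖f' s‖ ≤ K * ‖f s‖) → ‖f b‖ ≤ ‖f a‖ * Real.exp (K * (b - a)) := by
    intro f f' a b hab hf hK
    have := norm_le_gronwallBound_of_norm_deriv_right_le (f := f) (f' := f') (δ := ‖f a‖) (K := K)
      (ε := 0) (a := a) (b := b) (fun s _ => (hf s).continuousAt.continuousWithinAt)
      (fun s _ => (hf s).hasDerivWithinAt) le_rfl
      (fun s hs => by simpa using hK s (Ico_subset_Icc_self hs)) b ⟨hab, le_rfl⟩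
    rwa [gronwallBound_ε0] at this
  rcases le_total a b with hab | hab
  · rw [abs_of_nonneg (sub_nonneg.2 hab)]
    rw [uIcc_of_le hab] at hK
    exact key f f' a b hab hf hK
  · rw [abs_of_nonpos (sub_nonpos.2 hab)]
    rw [uIcc_of_ge hab] at hK
    have := key (fun s => f (-s)) (fun s => -f' (-s)) (-a) (-b) (neg_le_neg hab) (fun s => by
      have h := (hf (-s)).scomp s (hasDerivAt_neg s)
      rw [neg_one_smul] at h
      exact h) (fun s hs => by
        rw [norm_neg]
        exact hK (-s) ⟨by linarith [hs.2], by linarith [hs.1]⟩)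
    simp only [neg_neg] at this
    refine this.trans (le_of_eq ?_)
    congr 2
    ring

/-- Continuous dependence of constrained extremals on position and momentum. -/
theorem IsTonelliLagrangian.exists_comparison (hL : IsTonelliLagrangian L) (ρ t R : ℝ) :
    ∃ C : ℝ, 0 ≤ C ∧ ∀ (s₀ s₁ : ℝ) (γ q p γ' q' p' : ℝ → Space d),
      s₀ ∈ Icc 0 t → s₁ ∈ Icc 0 t →
      IsConstrainedExtremal L R (uIcc s₀ s₁) γ q p →
      IsConstrainedExtremal L R (uIcc s₀ s₁) γ' q' p' →
      (∀ s ∈ uIcc s₀ s₁, ‖γ s‖ ≤ ρ) → (∀ s ∈ uIcc s₀ s₁, ‖γ' s‖ ≤ ρ) →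
      ‖γ s₁ - γ' s₁‖ + ‖q s₁ - q' s₁‖ ≤ C * (‖γ s₀ - γ' s₀‖ + ‖p s₀ - p' s₀‖) := by
  obtain ⟨C₁, hC₁, hvel⟩ := hL.exists_constrainedVelocity_lipschitz ρ t R
  obtain ⟨C₂, hC₂, hgrad⟩ := exists_lipschitz_of_contDiff (contDiff_gradX hL.contDiff) ρ t R
  -- The velocity difference is at most 2C₁ times the sup norm of the pair of position and momentum
  -- differences; the second summand bounds the difference of the momentum derivatives.
  set K := C₁ * 2 + C₂ * (1 + C₁ * 2) with hK
  have hK0 : 0 ≤ K := by positivity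
  refine ⟨(1 + C₁ * 2) * Real.exp (K * t), by positivity, ?_⟩
  intro s₀ s₁ γ q p γ' q' p' hs₀ hs₁ h h' hρ hρ'
  set f : ℝ → Space d × Space d := fun s => (γ s - γ' s, p s - p' s) with hf
  have hsub : uIcc s₀ s₁ ⊆ Icc 0 t := ordConnected_Icc.uIcc_subset hs₀ hs₁
  have hf1 : ∀ s, ‖γ s - γ' s‖ ≤ ‖f s‖ := fun s => norm_fst_le (f s)
  have hf2 : ∀ s, ‖p s - p' s‖ ≤ ‖f s‖ := fun s => norm_snd_le (f s)
  have habs : ∀ s ∈ uIcc s₀ s₁, |s| ≤ t := fun s hs => by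
    rw [abs_of_nonneg (hsub hs).1]; exact (hsub hs).2
  have hq : ∀ s ∈ uIcc s₀ s₁, ‖q s - q' s‖ ≤ C₁ * 2 * ‖f s‖ := by
    intro s hs
    have h1 := hvel _ _ _ _ _ _ _ _ (hρ s hs) (hρ' s hs) (habs s hs) (habs s hs)
      (h.isConstrainedVelocity s hs) (h'.isConstrainedVelocity s hs)
    rw [sub_self, abs_zero, add_zero] at h1
    refine h1.trans ?_
    rw [mul_assoc]
    exact mul_le_mul_of_nonneg_left (by linarith [hf1 s, hf2 s]) hC₁
  have hbound := norm_le_mul_exp_of_norm_deriv_le (f := f)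
    (f' := fun s => (q s - q' s, gradX L (γ s) s (q s) - gradX L (γ' s) s (q' s))) (K := K)
    (a := s₀) (b := s₁)
    (fun s => ((h.hasDerivAt_curve s).sub (h'.hasDerivAt_curve s)).prodMk
      ((h.hasDerivAt_momentum s).sub (h'.hasDerivAt_momentum s)))
    (fun s hs => by
      have h1 := hq s hs
      have h2 := hgrad (γ s) (γ' s) s s (q s) (q' s) (hρ s hs) (hρ' s hs) (habs s hs) (habs s hs)
        (h.isConstrainedVelocity s hs).1 (h'.isConstrainedVelocity s hs).1
      rw [sub_self, abs_zero, add_zero] at h2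
      have h3 : C₂ * (‖γ s - γ' s‖ + ‖q s - q' s‖) ≤ C₂ * (1 + C₁ * 2) * ‖f s‖ := by
        rw [mul_assoc]
        exact mul_le_mul_of_nonneg_left (by linarith [hf1 s]) hC₂
      have h4 : 0 ≤ C₁ * 2 * ‖f s‖ := by positivity
      have h5 : 0 ≤ C₂ * (1 + C₁ * 2) * ‖f s‖ := by positivity
      rw [Prod.norm_def, hK, add_mul]
      exact max_le (by linarith) (by linarith))
  have hs1 : s₁ ∈ uIcc s₀ s₁ := right_mem_uIcc
  have hfs0 : ‖f s₀‖ ≤ ‖γ s₀ - γ' s₀‖ + ‖p s₀ - p' s₀‖ := by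
    rw [Prod.norm_def]
    exact max_le (le_add_of_nonneg_right (norm_nonneg _)) (le_add_of_nonneg_left (norm_nonneg _))
  have hexp : Real.exp (K * |s₁ - s₀|) ≤ Real.exp (K * t) := by
    refine Real.exp_le_exp.2 (mul_le_mul_of_nonneg_left ?_ hK0)
    rw [abs_le]
    constructor <;> linarith [hs₀.1, hs₀.2, hs₁.1, hs₁.2]
  calc ‖γ s₁ - γ' s₁‖ + ‖q s₁ - q' s₁‖ ≤ ‖f s₁‖ + C₁ * 2 * ‖f s₁‖ :=
        add_le_add (hf1 s₁) (hq s₁ hs1)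
    _ = (1 + C₁ * 2) * ‖f s₁‖ := by ring
    _ ≤ (1 + C₁ * 2) * ((‖γ s₀ - γ' s₀‖ + ‖p s₀ - p' s₀‖) * Real.exp (K * t)) := by
        refine mul_le_mul_of_nonneg_left (hbound.trans ?_) (by positivity)
        exact mul_le_mul hfs0 hexp (Real.exp_pos _).le (by positivity)
    _ = _ := by ring

/-- If a continuous function starts below the level `r` and reaches it, then it does so at a
point up to which it stays at or below `r`. -/
theorem exists_first_hit {u : ℝ → ℝ} (hu : Continuous u) {a b r : ℝ} (ha : u a < r) (hb : r ≤ u b) :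
    ∃ c ∈ uIcc a b, u c = r ∧ ∀ s ∈ uIcc a c, u s ≤ r := by
  have hZc : IsCompact (uIcc a b ∩ u ⁻¹' {r}) :=
    isCompact_uIcc.inter_right (isClosed_singleton.preimage hu)
  have hit : ∀ b, r ≤ u b → ∃ c ∈ uIcc a b, u c = r := by
    intro b hb
    obtain ⟨c, hc, he⟩ := intermediate_value_uIcc (hu.continuousOn (s := uIcc a b))
      (by rw [uIcc_of_le (ha.le.trans hb)]; exact ⟨ha.le, hb⟩ : r ∈ uIcc (u a) (u b))
    exact ⟨c, hc, he⟩
  obtain ⟨c₀, hc₀, he₀⟩ := hit b hb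
  -- The hitting point nearest to a, on whichever side b lies. Exceeding r before it would produce a
  -- nearer one.
  obtain ⟨c, ⟨hc, hcr⟩, hmin⟩ := hZc.exists_isMinOn ⟨c₀, hc₀, he₀⟩
    (f := fun s => |s - a|) (by fun_prop)
  refine ⟨c, hc, hcr, fun s hs => ?_⟩
  by_contra hlt
  rw [not_le] at hlt
  obtain ⟨c', hc', he'⟩ := hit s hlt.le
  have hsub : uIcc a s ⊆ uIcc a c := uIcc_subset_uIcc left_mem_uIcc hs
  have hsub' : uIcc a c ⊆ uIcc a b := uIcc_subset_uIcc left_mem_uIcc hc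
  have h1 : |c - a| ≤ |c' - a| := hmin ⟨hsub' (hsub hc'), he'⟩
  have h2 := abs_sub_left_of_mem_uIcc hs
  have h3 := abs_sub_left_of_mem_uIcc hc'
  have hne : c' ≠ s := fun h => by rw [h] at he'; linarith
  apply hne
  rcases le_total a s with h | h
  · rw [uIcc_of_le h] at hc'
    rw [abs_of_nonneg (sub_nonneg.2 hc'.1)] at h1 h3
    rw [abs_of_nonneg (sub_nonneg.2 h)] at h2 h3
    linarith
  · rw [uIcc_of_ge h] at hc'
    rw [abs_of_nonpos (sub_nonpos.2 hc'.2)] at h1 h3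
    rw [abs_of_nonpos (sub_nonpos.2 h)] at h2 h3
    linarith

theorem IsConstrainedExtremal.mono {R R' : ℝ} {I J : Set ℝ} {γ q p : ℝ → Space d}
    (h : IsConstrainedExtremal L R I γ q p) (hR : R' ≤ R) (hJ : J ⊆ I)
    (hq : ∀ s ∈ J, ‖q s‖ ≤ R') : IsConstrainedExtremal L R' J γ q p :=
  ⟨h.continuous_velocity, h.hasDerivAt_curve, h.hasDerivAt_momentum,
    fun s hs => (h.isConstrainedVelocity s (hJ hs)).mono_radius hR (hq s hs)⟩

/-- A solution of the Euler–Lagrange equation is a constrained extremal for every bound on its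
velocity. -/
theorem isConstrainedExtremal_of_solvesEulerLagrange {R : ℝ} {I : Set ℝ} {γ : ℝ → Space d}
    (hγ : ContDiff ℝ 2 γ) (hEL : SolvesEulerLagrange L univ γ) (hq : ∀ s ∈ I, ‖deriv γ s‖ ≤ R) :
    IsConstrainedExtremal L R I γ (deriv γ) fun s => gradXi L (γ s) s (deriv γ s) := by
  refine ⟨hγ.continuous_deriv (by norm_num),
    fun s => (hγ.differentiable (by norm_num) s).hasDerivAt, fun s => ?_,
    fun s hs => isConstrainedVelocity_gradXi _ _ (hq s hs)⟩
  simpa [derivWithin_univ, hasDerivWithinAt_univ] using hEL s (mem_univ s)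

/-- A control must obey its bound at all times, while the action only sees [0,t]; cutting off
outside reconciles the two. -/
theorem IsControl.exists_of_norm_le {R R' t : ℝ} {y x : Space d} {q : ℝ → Space d} (ht : 0 ≤ t)
    (h : IsControl R t y x q) (hq : ∀ s ∈ Icc 0 t, ‖q s‖ ≤ R') :
    ∃ w, IsControl R' t y x w ∧ controlAction L t y w = controlAction L t y q := by
  have hR' : 0 ≤ R' := (norm_nonneg _).trans (hq 0 ⟨le_rfl, ht⟩)
  have e : ∀ s ∈ Icc 0 t, (Icc 0 t).indicator q s = q s := fun s hs => indicator_of_mem hs q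
  have hpos : ∀ s ∈ Icc 0 t, position y ((Icc 0 t).indicator q) s = position y q s := by
    intro s hs
    rw [position, position]
    congr 1
    refine intervalIntegral.integral_congr fun r hr => ?_
    rw [uIcc_of_le hs.1] at hr
    exact e r ⟨hr.1, hr.2.trans hs.2⟩
  refine ⟨(Icc 0 t).indicator q, ⟨h.measurable.indicator measurableSet_Icc, fun s => ?_, ?_⟩, ?_⟩
  · by_cases hs : s ∈ Icc 0 t
    · rw [e s hs]
      exact hq s hs
    · rw [indicator_of_notMem hs, norm_zero]
      exact hR'
  · rw [hpos t ⟨ht, le_rfl⟩, h.position_end]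
  · refine intervalIntegral.integral_congr fun s hs => ?_
    rw [uIcc_of_le ht] at hs
    simp only [hpos s hs, e s hs]

end Comparison

/-! ### Removing the velocity bound -/

section Minimizer

variable {d : ℕ} {L : Space d → ℝ → Space d → ℝ}

theorem IsControl.mono {R R' t : ℝ} {y x : Space d} {q : ℝ → Space d} (h : IsControl R t y x q)
    (hR : R ≤ R') : IsControl R' t y x q :=
  ⟨h.measurable, fun s => (h.norm_le s).trans hR, h.position_end⟩

/-- Superlinearity with slope 1, integrated. The essential point is that B does not depend on the
velocity bound R. -/
theorem IsTonelliLagrangian.exists_integral_norm_le (hL : IsTonelliLagrangian L) {t : ℝ}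
    (ht : 0 ≤ t) (y : Space d) (A : ℝ) :
    ∃ B : ℝ, ∀ (R : ℝ) (x : Space d) (q : ℝ → Space d), IsControl R t y x q →
      controlAction L t y q ≤ A → ∫ s in (0 : ℝ)..t, ‖q s‖ ≤ B := by
  obtain ⟨b, hb⟩ := hL.superlinear 1 zero_le_one
  refine ⟨A - t * b, fun R x q hq hA => ?_⟩
  have hi : IntervalIntegrable (fun s => ‖q s‖) volume 0 t :=
    (intervalIntegrable_of_norm_le hq.measurable hq.norm_le 0 t).norm
  have h1 : ∫ s in (0 : ℝ)..t, (‖q s‖ + b) ≤ controlAction L t y q :=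
    intervalIntegral.integral_mono_on ht (hi.add (by simp))
      (intervalIntegrable_comp_position hL.contDiff.continuous ht y hq.measurable hq.norm_le
        hq.measurable hq.norm_le) fun s _ => by simpa using hb (position y q s) s (q s)
  rw [intervalIntegral.integral_add hi (by simp), intervalIntegral.integral_const, sub_zero,
    smul_eq_mul] at h1
  linarith

theorem norm_position_le_integral {q : ℝ → Space d} (hq : Measurable q) {R : ℝ}
    (hb : ∀ s, ‖q s‖ ≤ R) (y : Space d) {s t : ℝ} (hs : s ∈ Icc 0 t) :
    ‖position y q s‖ ≤ ‖y‖ + ∫ r in (0 : ℝ)..t, ‖q r‖ := by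
  refine (norm_add_le _ _).trans (add_le_add le_rfl ?_)
  refine (intervalIntegral.norm_integral_le_integral_norm hs.1).trans ?_
  exact intervalIntegral.integral_mono_interval le_rfl hs.1 hs.2
    (Filter.Eventually.of_forall fun r => norm_nonneg _)
    (intervalIntegrable_of_norm_le hq hb 0 t).norm

theorem exists_norm_le_of_integral_norm_le {q : ℝ → Space d} (hq : Continuous q) {t B : ℝ}
    (ht : 0 < t) (hB : ∫ s in (0 : ℝ)..t, ‖q s‖ ≤ B) : ∃ s ∈ Icc 0 t, ‖q s‖ ≤ B / t := by
  by_contra! hcon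
  have h1 : ∫ _ in (0 : ℝ)..t, B / t < ∫ s in (0 : ℝ)..t, ‖q s‖ :=
    intervalIntegral.integral_lt_integral_of_continuousOn_of_le_of_exists_lt ht
      continuousOn_const hq.norm.continuousOn (fun s hs => (hcon s (Ioc_subset_Icc_self hs)).le)
      ⟨0, ⟨le_rfl, ht.le⟩, hcon 0 ⟨le_rfl, ht.le⟩⟩
  rw [intervalIntegral.integral_const, sub_zero, smul_eq_mul, mul_div_cancel₀ _ ht.ne'] at h1
  linarith

/-- Constrained extremals for large bounds, passing through a bounded set of positions and
velocities, obey a common smaller velocity bound along a subsequence. -/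
theorem IsTonelliLagrangian.exists_subseq_velocity_lt (hL : IsTonelliLagrangian L) {t B ρ : ℝ}
    {R : ℕ → ℝ} (hR : Filter.Tendsto R Filter.atTop Filter.atTop)
    {γ q p : ℕ → ℝ → Space d}
    (hext : ∀ n, IsConstrainedExtremal L (R n) (Icc 0 t) (γ n) (q n) (p n))
    (hρ : ∀ n, ∀ s ∈ Icc 0 t, ‖γ n s‖ ≤ ρ) (hB : ∀ n, ∃ s ∈ Icc 0 t, ‖q n s‖ ≤ B) :
    ∃ R' : ℝ, ∃ φ : ℕ → ℕ, StrictMono φ ∧ ∀ n, R' ≤ R (φ n) ∧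
      ∀ s ∈ Icc 0 t, ‖q (φ n) s‖ < R' := by
  choose σ hσ hσB using hB
  have hcomp : IsCompact (Icc 0 t ×ˢ (Metric.closedBall (0 : Space d) ρ ×ˢ
      Metric.closedBall (0 : Space d) B)) :=
    isCompact_Icc.prod ((isCompact_closedBall _ _).prod (isCompact_closedBall _ _))
  obtain ⟨⟨s', x', v'⟩, hmem, φ, hφ, hlim⟩ := hcomp.tendsto_subseq
    (x := fun n => (σ n, γ n (σ n), q n (σ n)))
    (fun n => ⟨hσ n, by simpa using hρ n _ (hσ n), by simpa using hσB n⟩)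
  obtain ⟨ζ, hζ, hζx, hζv, hEL⟩ := hL.complete s' x' v'
  have hlim1 : Filter.Tendsto (fun n => σ (φ n)) Filter.atTop (𝓝 s') :=
    (continuous_fst.tendsto _).comp hlim
  have hlim2 : Filter.Tendsto (fun n => γ (φ n) (σ (φ n))) Filter.atTop (𝓝 x') :=
    ((continuous_fst.comp continuous_snd).tendsto _).comp hlim
  have hgc := (contDiff_gradXi hL.contDiff).continuous
  have hζ'c : Continuous (deriv ζ) := hζ.continuous_deriv (by norm_num)
  obtain ⟨V, hV⟩ := isCompact_Icc.exists_bound_of_continuousOn (s := Icc 0 t) hζ'c.continuousOn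
  obtain ⟨X, hX⟩ :=
    isCompact_Icc.exists_bound_of_continuousOn (s := Icc 0 t) hζ.continuous.continuousOn
  -- The margin 1 above `V` is what the comparison estimate `< 1` will contradict; being above `B`
  -- makes the constraint inactive at the times σ.
  set R' := max V B + 1 with hR'
  have hVR : V ≤ R' - 1 := by rw [hR']; linarith [le_max_left V B]
  have hBR : B < R' := by rw [hR']; linarith [le_max_right V B]
  have hζext := isConstrainedExtremal_of_solvesEulerLagrange (R := R') (I := Icc 0 t) hζ hEL
    fun s hs => (hV s hs).trans (by linarith)
  obtain ⟨C, hC, hcmp⟩ := hL.exists_comparison (max ρ X) t R'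
  have hRφ := (hR.comp hφ.tendsto_atTop).eventually_ge_atTop R'
  -- The comparison needs momenta to converge. At σ the velocity is interior to the ball, so the
  -- momentum is ∂L/∂ξ there.
  have hp : ∀ᶠ n in Filter.atTop, gradXi L (γ (φ n) (σ (φ n))) (σ (φ n)) (q (φ n) (σ (φ n))) =
      p (φ n) (σ (φ n)) := by
    filter_upwards [hRφ] with n hn
    exact ((hext (φ n)).isConstrainedVelocity _ (hσ _)).gradXi_eq
      (lt_of_le_of_lt (hσB _) (hBR.trans_le hn))
  have hplim : Filter.Tendsto (fun n => p (φ n) (σ (φ n))) Filter.atTop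
      (𝓝 (gradXi L x' s' v')) := by
    refine Filter.Tendsto.congr' hp ?_
    exact (hgc.tendsto (x', s', v')).comp (f := fun n =>
      (γ (φ n) (σ (φ n)), σ (φ n), q (φ n) (σ (φ n))))
      (hlim2.prodMk_nhds (hlim1.prodMk_nhds
        (((continuous_snd.comp continuous_snd).tendsto _).comp hlim)))
  have hζlim : Filter.Tendsto (fun n => ζ (σ (φ n))) Filter.atTop (𝓝 x') := by
    rw [← hζx]
    exact (hζ.continuous.tendsto s').comp hlim1
  have hζplim : Filter.Tendsto (fun n => gradXi L (ζ (σ (φ n))) (σ (φ n)) (deriv ζ (σ (φ n))))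
      Filter.atTop (𝓝 (gradXi L x' s' v')) := by
    rw [← hζx, ← hζv]
    have : Continuous fun s => gradXi L (ζ s) s (deriv ζ s) :=
      hgc.comp (hζ.continuous.prodMk (continuous_id.prodMk hζ'c))
    exact (this.tendsto s').comp hlim1
  have hsmall : ∀ᶠ n in Filter.atTop, C * (‖γ (φ n) (σ (φ n)) - ζ (σ (φ n))‖ +
      ‖p (φ n) (σ (φ n)) - gradXi L (ζ (σ (φ n))) (σ (φ n)) (deriv ζ (σ (φ n)))‖) < 1 := by
    have h0 : Filter.Tendsto (fun n => C * (‖γ (φ n) (σ (φ n)) - ζ (σ (φ n))‖ +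
      ‖p (φ n) (σ (φ n)) - gradXi L (ζ (σ (φ n))) (σ (φ n)) (deriv ζ (σ (φ n)))‖)) Filter.atTop
        (𝓝 0) := by
      simpa using (((hlim2.sub hζlim).norm).add ((hplim.sub hζplim).norm)).const_mul C
    exact h0.eventually_lt_const one_pos
  obtain ⟨N, hN⟩ := Filter.eventually_atTop.1 (hRφ.and hsmall)
  refine ⟨R', fun n => φ (n + N), fun a b hab => hφ (by omega), fun n => ?_⟩
  obtain ⟨h1, h2⟩ := hN (n + N) (by omega)
  refine ⟨h1, fun s hs => ?_⟩
  by_contra! hge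
  set k := φ (n + N) with hk
  -- Up to the first time, forward or backward from σ, at which the speed reaches `R'`, the curve is
  -- an extremal for the bound `R'`. So the constant `C`, independent of k, applies and keeps its
  -- velocity within 1 of that of ζ: a contradiction.
  obtain ⟨c, hc, hce, hcle⟩ := exists_first_hit (hext k).continuous_velocity.norm (a := σ k) (b := s)
    (lt_of_le_of_lt (hσB k) hBR) hge
  have hct : c ∈ Icc 0 t := ordConnected_Icc.uIcc_subset (hσ k) hs hc
  have hsub : uIcc (σ k) c ⊆ Icc 0 t := ordConnected_Icc.uIcc_subset (hσ k) hct
  have h3 := hcmp (σ k) c _ _ _ _ _ _ (hσ k) hct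
    ((hext k).mono h1 hsub hcle)
    (hζext.mono le_rfl hsub fun r hr => (hV r (hsub hr)).trans (by linarith))
    (fun r hr => (hρ k r (hsub hr)).trans (le_max_left _ _))
    (fun r hr => (hX r (hsub hr)).trans (le_max_right _ _))
  have h4 := norm_sub_norm_le (q k c) (deriv ζ c)
  have h5 := hV c hct
  have h6 := norm_nonneg (γ k c - ζ c)
  linarith

/-- Existence of a minimizer among all curves with bounded measurable velocity. -/
theorem IsTonelliLagrangian.exists_extremal_min (hL : IsTonelliLagrangian L) {t : ℝ} (ht : 0 < t)
    (y x : Space d) :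
    ∃ ζ : ℝ → Space d, ContDiff ℝ 2 ζ ∧ SolvesEulerLagrange L univ ζ ∧ ζ 0 = y ∧ ζ t = x ∧
      ∀ (R : ℝ) (w : ℝ → Space d), IsControl R t y x w →
        ∫ s in (0 : ℝ)..t, L (ζ s) s (deriv ζ s) ≤ controlAction L t y w := by
  -- Strictly above the mean speed needed to reach x, as the multiplier argument demands.
  set R : ℕ → ℝ := fun n => ‖x - y‖ / t + 1 + n with hRdef
  have hRn : ∀ n, ‖x - y‖ < R n * t := by
    intro n
    rw [← div_lt_iff₀ ht, hRdef]
    have : (0 : ℝ) ≤ n := n.cast_nonneg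
    simp only
    linarith
  have hRlim : Filter.Tendsto R Filter.atTop Filter.atTop :=
    Filter.tendsto_atTop_add_const_left _ _ tendsto_natCast_atTop_atTop
  choose q p hq hmin hext using fun n => hL.exists_constrainedExtremal_min ht (hRn n)
  obtain ⟨B, hB⟩ := hL.exists_integral_norm_le ht.le y
    (controlAction L t y fun _ => t⁻¹ • (x - y))
  have hqB : ∀ n, ∫ s in (0 : ℝ)..t, ‖q n s‖ ≤ B := fun n =>
    hB _ _ _ (hq n) (hmin n _ (isControl_const ht (hRn n).le))
  have hρ : ∀ n, ∀ s ∈ Icc 0 t, ‖position y (q n) s‖ ≤ ‖y‖ + B := fun n s hs =>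
    (norm_position_le_integral (hq n).measurable (hq n).norm_le y hs).trans
      (add_le_add le_rfl (hqB n))
  obtain ⟨R', φ, hφ, hR'⟩ := hL.exists_subseq_velocity_lt hRlim hext hρ fun n =>
    exists_norm_le_of_integral_norm_le (hext n).continuous_velocity ht (hqB n)
  set k := φ 0 with hk
  obtain ⟨hkR, hkv⟩ := hR' 0
  have h0 : (0 : ℝ) ∈ Icc 0 t := ⟨le_rfl, ht.le⟩
  -- The Euler–Lagrange solution with the same initial data coincides with the minimizer on [0,t] by
  -- comparison, which yields its C² regularity.
  obtain ⟨ζ, hζ, hζ0, hζv, hEL⟩ := hL.complete 0 y (q k 0)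
  have hζ'c : Continuous (deriv ζ) := hζ.continuous_deriv (by norm_num)
  obtain ⟨V, hV⟩ := isCompact_Icc.exists_bound_of_continuousOn (s := Icc 0 t) hζ'c.continuousOn
  obtain ⟨X, hX⟩ :=
    isCompact_Icc.exists_bound_of_continuousOn (s := Icc 0 t) hζ.continuous.continuousOn
  have hζext := isConstrainedExtremal_of_solvesEulerLagrange (R := max V R') (I := Icc 0 t) hζ hEL
    fun s hs => (hV s hs).trans (le_max_left _ _)
  have hpk : ∀ s ∈ Icc 0 t, gradXi L (position y (q k) s) s (q k s) = p k s := fun s hs =>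
    ((hext k).isConstrainedVelocity s hs).gradXi_eq ((hkv s hs).trans_le hkR)
  have hkext : IsConstrainedExtremal L (max V R') (Icc 0 t) (position y (q k)) (q k) (p k) :=
    ⟨(hext k).continuous_velocity, (hext k).hasDerivAt_curve, (hext k).hasDerivAt_momentum,
      fun s hs => by
        rw [← hpk s hs]
        exact isConstrainedVelocity_gradXi _ _ ((hkv s hs).le.trans (le_max_right _ _))⟩
  obtain ⟨C, hC, hcmp⟩ := hL.exists_comparison (max (‖y‖ + B) X) t (max V R')
  have heq : ∀ s ∈ Icc 0 t, position y (q k) s = ζ s ∧ q k s = deriv ζ s := by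
    intro s hs
    have hsub : uIcc 0 s ⊆ Icc 0 t := ordConnected_Icc.uIcc_subset h0 hs
    have h1 := hcmp 0 s _ _ _ _ _ _ h0 hs
      (hkext.mono le_rfl hsub fun r hr => (hkext.isConstrainedVelocity r (hsub hr)).1)
      (hζext.mono le_rfl hsub fun r hr => (hζext.isConstrainedVelocity r (hsub hr)).1)
      (fun r hr => (hρ k r (hsub hr)).trans (le_max_left _ _))
      (fun r hr => (hX r (hsub hr)).trans (le_max_right _ _))
    rw [← hpk 0 h0, position_zero, hζ0, hζv, sub_self, sub_self, norm_zero, add_zero,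
      mul_zero] at h1
    have h2 := norm_nonneg (position y (q k) s - ζ s)
    have h3 := norm_nonneg (q k s - deriv ζ s)
    exact ⟨sub_eq_zero.1 (norm_le_zero_iff.1 (by linarith)),
      sub_eq_zero.1 (norm_le_zero_iff.1 (by linarith))⟩
  refine ⟨ζ, hζ, hEL, hζ0, ?_, fun r w hw => ?_⟩
  · rw [← (heq t ⟨ht.le, le_rfl⟩).1, (hq k).position_end]
  · have e : ∫ s in (0 : ℝ)..t, L (ζ s) s (deriv ζ s) = controlAction L t y (q k) := by
      refine intervalIntegral.integral_congr fun s hs => ?_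
      rw [uIcc_of_le ht.le] at hs
      simp only [(heq s hs).1, (heq s hs).2]
    rw [e]
    -- The minimizer for a bound beyond r has speed below `R' ≤ R k` on [0,t], so up to a cutoff it
    -- competes in problem k; hence minimality in problem k extends to every r.
    obtain ⟨n, hn⟩ := ((hRlim.comp hφ.tendsto_atTop).eventually_ge_atTop r).exists
    obtain ⟨w', hw', hact⟩ := (hq (φ n)).exists_of_norm_le (L := L) ht.le
      fun s hs => ((hR' n).2 s hs).le.trans hkR
    exact (hmin k w' hw').trans (hact.trans_le (hmin (φ n) w (hw.mono hn)))

end Minimizer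

/-! ### Piecewise C¹ curves as controls -/

section PiecewiseC1

variable {d : ℕ} {L : Space d → ℝ → Space d → ℝ}

theorem IsPiecewiseC1.exists_finite_norm_deriv_le {t : ℝ} {γ : ℝ → Space d}
    (h : IsPiecewiseC1 t γ) :
    ∃ (D : Set ℝ) (M : ℝ), D.Finite ∧ 0 ≤ M ∧
      ∀ s ∈ Ioo 0 t \ D, DifferentiableAt ℝ γ s ∧ ‖deriv γ s‖ ≤ M := by
  obtain ⟨-, m, τ, -, hτ0, hτm, hτ⟩ := h
  have hM : ∀ l, ∃ M : ℝ, l < m → ∀ s ∈ Icc (τ l) (τ (l + 1)),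
      ‖derivWithin γ (Icc (τ l) (τ (l + 1))) s‖ ≤ M := by
    intro l
    by_cases hl : l < m
    · obtain ⟨M, hM⟩ := isCompact_Icc.exists_bound_of_continuousOn
        ((hτ l hl).2.continuousOn_derivWithin (uniqueDiffOn_Icc (hτ l hl).1) le_rfl)
      exact ⟨M, fun _ => hM⟩
    · exact ⟨0, fun h => absurd h hl⟩
  choose M hM using hM
  refine ⟨τ '' Finset.range (m + 1), ∑ l ∈ Finset.range m, |M l|,
    (Finset.finite_toSet _).image τ, Finset.sum_nonneg fun _ _ => abs_nonneg _, ?_⟩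
  rintro s ⟨hs, hsD⟩
  -- The least such index is the right end of the piece containing s.
  have hex : ∃ k, s ≤ τ k := ⟨m, hτm ▸ hs.2.le⟩
  classical
  have hk : s ≤ τ (Nat.find hex) := Nat.find_spec hex
  have hkm : Nat.find hex ≤ m := Nat.find_min' hex (hτm ▸ hs.2.le)
  obtain ⟨l, hl⟩ : ∃ l, Nat.find hex = l + 1 := by
    refine Nat.exists_eq_succ_of_ne_zero fun h0 => ?_
    rw [h0, hτ0] at hk
    exact absurd hs.1 (not_lt.2 hk)
  have hlt : τ l < s := not_le.1 (Nat.find_min hex (by omega))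
  rw [hl] at hk hkm
  have hlm : l < m := by omega
  have hne : s ≠ τ (l + 1) := fun he => hsD ⟨l + 1, by simpa using hkm, he.symm⟩
  have hmem : s ∈ Ioo (τ l) (τ (l + 1)) := ⟨hlt, lt_of_le_of_ne hk hne⟩
  have hnhds : Icc (τ l) (τ (l + 1)) ∈ 𝓝 s := Icc_mem_nhds hmem.1 hmem.2
  refine ⟨((hτ l hlm).2.contDiffAt hnhds).differentiableAt (by norm_num), ?_⟩
  rw [← derivWithin_of_mem_nhds hnhds]
  refine (hM l hlm s (Ioo_subset_Icc_self hmem)).trans ((le_abs_self _).trans ?_)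
  exact Finset.single_le_sum (f := fun l => |M l|) (fun _ _ => abs_nonneg _)
    (Finset.mem_range.2 hlm)

/-- The velocity of an admissible curve is a control with the same action. -/
theorem exists_isControl_of_admissible {t : ℝ} (ht : 0 < t) {y x : Space d} {γ : ℝ → Space d}
    (hγ : γ ∈ admissibleCurves t y x) :
    ∃ (R : ℝ) (w : ℝ → Space d), IsControl R t y x w ∧
      ∀ᵐ s, s ∈ Ioc 0 t → lagrangianAlong L t γ s = L (position y w s) s (w s) := by
  obtain ⟨hpw, hγ0, hγt⟩ := hγ
  obtain ⟨D, M, hD, hM0, hDM⟩ := hpw.exists_finite_norm_deriv_le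
  -- Truncation supplies a global bound; off [0,t] nothing is known about γ.
  set w : ℝ → Space d := fun s => if ‖deriv γ s‖ ≤ M then deriv γ s else 0 with hw
  have hdm : Measurable (deriv γ) := measurable_deriv γ
  have hwm : Measurable w :=
    Measurable.ite (measurableSet_le hdm.norm measurable_const) hdm measurable_const
  have hwb : ∀ s, ‖w s‖ ≤ M := by
    intro s
    simp only [hw]
    split_ifs with h
    · exact h
    · simpa using hM0
  have hweq : ∀ s ∈ Ioo 0 t \ D, w s = deriv γ s := fun s hs => if_pos (hDM s hs).2
  have hpos : ∀ s ∈ Icc 0 t, position y w s = γ s := by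
    intro s hs
    have h1 := integral_eq_of_hasDerivAt_off_countable γ w (a := 0) (b := s) hD.countable
      (hpw.1.mono (by rw [uIcc_of_le hs.1]; exact Icc_subset_Icc_right hs.2))
      (fun r hr => by
        rw [min_eq_left hs.1, max_eq_right hs.1] at hr
        have hr' : r ∈ Ioo 0 t \ D := ⟨⟨hr.1.1, hr.1.2.trans_le hs.2⟩, hr.2⟩
        rw [hweq r hr']
        exact (hDM r hr').1.hasDerivAt)
      (intervalIntegrable_of_norm_le hwm hwb 0 s)
    rw [position, h1, hγ0]
    abel
  refine ⟨M, w, ⟨hwm, hwb, by rw [hpos t ⟨ht.le, le_rfl⟩, hγt]⟩, ?_⟩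
  -- The end point t is discarded as well, since the one-sided derivative need not equal `deriv γ
  -- t`.
  have hnull : ∀ᵐ s : ℝ, s ∉ D ∪ {t} :=
    ((hD.union (finite_singleton t)).countable).ae_notMem volume
  filter_upwards [hnull] with s hs hs'
  rw [mem_union, not_or] at hs
  have hst : s < t := lt_of_le_of_ne hs'.2 hs.2
  rw [lagrangianAlong, hpos s (Ioc_subset_Icc_self hs'), hweq s ⟨⟨hs'.1, hst⟩, hs.1⟩,
    derivWithin_of_mem_nhds (Icc_mem_nhds hs'.1 hst)]

end PiecewiseC1

/-! ### Conclusion: integrability and the minimizing curve -/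

theorem mainTheorem2 {d : ℕ} (L : Space d → ℝ → Space d → ℝ) (hL : IsTonelliLagrangian L)
    (t : ℝ) (ht : 0 < t) (xtilde x : Space d) :
    (∀ γ ∈ admissibleCurves t xtilde x,
      IntervalIntegrable (lagrangianAlong L t γ) volume 0 t) ∧
    ∃ γ ∈ admissibleCurves t xtilde x,
      IsMinOn (action L t) (admissibleCurves t xtilde x) γ ∧
      ContDiffOn ℝ 2 γ (Icc 0 t) ∧
      SolvesEulerLagrange L (Icc 0 t) γ := by
  refine ⟨fun γ hγ => ?_, ?_⟩
  · obtain ⟨R, w, hw, hae⟩ := exists_isControl_of_admissible (L := L) ht hγ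
    refine (intervalIntegrable_comp_position hL.contDiff.continuous ht.le xtilde hw.measurable
      hw.norm_le hw.measurable hw.norm_le).congr_ae ?_
    rw [uIoc_of_le ht.le, Filter.EventuallyEq, ae_restrict_iff' measurableSet_Ioc]
    filter_upwards [hae] with s hs hs'
    exact (hs hs').symm
  · obtain ⟨ζ, hζ, hEL, hζ0, hζt, hmin⟩ := hL.exists_extremal_min ht xtilde x
    have hder : ∀ s ∈ Icc 0 t, derivWithin ζ (Icc 0 t) s = deriv ζ s := fun s hs =>
      (hζ.differentiable (by norm_num) s).derivWithin (uniqueDiffOn_Icc ht s hs)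
    refine ⟨ζ, ⟨⟨hζ.continuous.continuousOn, 1, fun l => l * t, le_rfl, by simp, by simp, ?_⟩,
      hζ0, hζt⟩, fun η hη => ?_, hζ.contDiffOn, fun s hs => ?_⟩
    · intro l hl
      obtain rfl : l = 0 := by omega
      exact ⟨by simpa using ht, (hζ.of_le (by norm_num)).contDiffOn⟩
    · obtain ⟨R, w, hw, hae⟩ := exists_isControl_of_admissible (L := L) ht hη
      have e1 : action L t η = controlAction L t xtilde w := by
        refine intervalIntegral.integral_congr_ae ?_
        rw [uIoc_of_le ht.le]
        exact hae
      have e2 : action L t ζ = ∫ s in (0 : ℝ)..t, L (ζ s) s (deriv ζ s) := by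
        refine intervalIntegral.integral_congr fun s hs => ?_
        rw [uIcc_of_le ht.le] at hs
        simp only [lagrangianAlong, hder s hs]
      change action L t ζ ≤ action L t η
      rw [e1, e2]
      exact hmin R w hw
    · have h1 := (hEL s (mem_univ s)).mono (subset_univ (Icc 0 t))
      simp only [derivWithin_univ] at h1
      rw [hder s hs]
      exact h1.congr (fun r hr => by rw [hder r hr]) (by rw [hder s hs])
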